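/- **Setting: programs.** Let $\mathcal X,\mathcal G$ be sets of local and global variables, $\mathcal V$ a set of values containing the set $\mathcal I$ of thread ids (with $0\in\mathcal I$ the initial id), $\mathsf M$ a finite set of mutexes with a mutex $m_g$ for every $g\in\mathcal G$, $\mathcal N$ a set of program points with start point $u_0$, and $\mathcal E$ a set of control-flow edges $(u,A,u')$, where $A$ is a guard on locals, an assignment $x=r$ to a local, $x=\mathsf{create}(u_1)$, $\mathsf{lock}(a)$, $\mathsf{unlock}(a)$, a read $x=g$ or a write $g=x$. A distinguished local $\mathsf{self}$ holds the thread id and is never assigned explicitly, at each program point at most one edge creates a thread, and each access $A$ to $g$ occurs as $\mathsf{lock}(m_g);A;\mathsf{unlock}(m_g)$. **Local traces.** A global trace consists of one finite raw execution $\bar u_0a_1\bar u_1\dots a_n\bar u_n$ along control-flow edges for each thread id in some set, with nodes $\bar u_j=(j,u_j,\sigma_j)$, a create order $\to_c$ from creating nodes to the first nodes of created threads, and for every mutex $a$ a locking order $\to_a$ that assigns to every $\mathsf{lock}(a)$ exactly one preceding $\mathsf{unlock}(a)$ (or the root), each of these being followed by at most one $\mathsf{lock}(a)$. Every thread other than the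 initial one is created exactly once, with the local state of its creator except for $\mathsf{self}$. The causality order, generated by the program order, $\to_c$ and all $\to_a$, is a partial order with the initial node of thread $0$ as least element. Mutexes are not re-entrant and are released only while held, and every read of $g$ returns the value of the maximal write to $g$ that precedes it. A local trace is a global trace with a greatest node, its sink; the thread of the sink is the ego thread. $\mathsf{loc}(t)$ is the program point of the sink, and $L_t[\bar u]$ is the set of mutexes held by the thread of $\bar u$ at $\bar u$. $\mathsf{init}$ consists of the one-node traces at $u_0$ with $\mathsf{self}=0$ and arbitrary other locals. For an edge $e=(u,A,u')$ the operation $[\![e]\!]$ prolongs the ego thread of a local trace at $u$ by $A$; for $A=\mathsf{lock}(a)$ it also merges in a second local trace, which is in $\mathsf{init}$ or ends with $\mathsf{unlock}(a)$, and whose sink becomes the $\to_a$-predecessor. $\mathsf{new}\,u_1\,t$ starts from the sink of $t$ a thread at $u_1$ with id $\nu(t)$, for a given map $\nu$ from local traces to $\mathcal I$; executing $x=\mathsf{create}(u_1)$ after $t$ sets $x$ to $\nu(t)$. $\mathcal T$ is the least set of local traces that contains $\mathsf{init}$ and is closed under $\mathsf{new}$ and all $[\![e]\!]$. The local constraint system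 $\mathcal C$ has unknowns $[u]$, $[a]$ with values in sets of local traces and the constraints $[u_0]\supseteq\mathsf{init}$, $[a]\supseteq\mathsf{init}$ and, for each $e=(u,A,u')\in\mathcal E$: $[u']\supseteq[\![e]\!](\eta[u],\eta[a])$ if $A=\mathsf{lock}(a)$, and $[u']\supseteq[\![e]\!](\eta[u])$ otherwise, with the side-effect $[a]\supseteq[\![e]\!](\eta[u])$ if $A=\mathsf{unlock}(a)$, and $[u_1]\supseteq\mathsf{new}\,u_1(\eta[u])$ if $A=(x=\mathsf{create}(u_1))$. Let $\eta$ be its least solution. **The analysis.** Let $\mathcal D$ be a complete lattice with a monotone $\gamma_{\mathcal D}:\mathcal D\to2^{\mathcal V}$ with $\gamma_{\mathcal D}(\top)=\mathcal V$. Let $\mathcal U$ be the lattice of upward-closed sets of subsets of $\mathsf M$ ordered by inclusion, each represented by its set of minimal elements, so that $\emptyset$ is least and $\{\emptyset\}$ greatest. The system $\mathcal C_3$ has unknowns $[u,S]$ ($u\in\mathcal N$, $S\subseteq\mathsf M$) with values $(W,P,\sigma)$, $W,P:\mathcal G\to\mathcal U$, $\sigma:\mathcal X\cup\mathcal G\to\mathcal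 D$, and $[g,a,S,w]$ ($g\in\mathcal G$, $a\in\mathsf M$, $S,w\subseteq\mathsf M$) with values in $\mathcal D$. Its constraints are $[u_0,\emptyset]\sqsupseteq(\lambda g.\emptyset,\ \lambda g.\{\emptyset\},\ \{x\mapsto\top\}\cup\{g\mapsto\bot\})$ and, for each edge $(u,A,v)$ and each $S\subseteq\mathsf M$, with $(W,P,\sigma)=\eta_3[u,S]$: * guard, $x=r$: $[v,S]\sqsupseteq(W,P,\sigma')$, where $\sigma'$ results from $\sigma$ by a sound abstract transfer function; * $x=\mathsf{create}(u_1)$: $[v,S]\sqsupseteq(W,P,\sigma\oplus\{x\mapsto i\})$ with side-effect $(\lambda g.\emptyset,\ \lambda g.\{\emptyset\},\ \sigma\oplus(\{\mathsf{self}\mapsto i\}\cup\{g\mapsto\bot\mid g\in\mathcal G\}))$ to $[u_1,\emptyset]$, where $i=\nu^\sharp\,u\,(W,P,\sigma)\,u_1$ and $\nu^\sharp$ soundly abstracts $\nu$; * $\mathsf{lock}(a)$: $[v,S\cup\{a\}]\sqsupseteq(W,P,\sigma)$; * $\mathsf{unlock}(a)$: $[v,S\setminus\{a\}]\sqsupseteq(W,\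 \lambda g.\,P\,g\sqcup\{S\setminus\{a\}\},\ \sigma)$ with side-effects $\sigma\,g$ to $[g,a,S\setminus\{a\},w]$ for all $g\in\mathcal G$ and all (minimal) $w\in W\,g$; * $g=x$: $[v,S]\sqsupseteq(W\oplus\{g\mapsto\{S\}\},\ P\oplus\{g\mapsto\{S\}\},\ \sigma\oplus\{g\mapsto\sigma\,x\})$; * $x=g$: $[v,S]\sqsupseteq(W,P,\sigma\oplus\{x\mapsto d\})$ with $d=\sigma\,g\sqcup\bigsqcup\{\eta_3[g,a,S',w]\mid a\in S,\ S\cap S'=\emptyset,\ \exists S''\in P\,g:S''\cap w=\emptyset,\ \exists S'''\in P\,g:a\notin S'''\}$. A post-solution of $\mathcal C_3$ is an assignment $\eta_3$ of the unknowns for which all contributions and side-effects of all constraints are below the values of $\eta_3$. **Abstraction.** A thread-local write to $g$ in $t$ is an edge $(\bar v,g=x,\bar v')$ of the ego thread of $t$. For a local trace $t$ let $\beta\,t=(W_t,P_t,\sigma_t)$: $\sigma_t\,x=\{t(x)\}$, where $t(x)$ is the value of the local $x$ at the sink. If there is a last thread-local write $(\bar v,g=x,\bar v')$ to $g$ in $t$,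 then $W_t\,g=\{L_t[\bar v']\}$, $P_t\,g$ is the upward closure of the set of locksets the ego thread has held since $\bar v'$, and $\sigma_t\,g$ consists of the value written; otherwise $W_t\,g=\emptyset$, $P_t\,g=\{\emptyset\}$ and $\sigma_t\,g=\emptyset$. Let $\mathcal T_S$ be the set of $t\in\mathcal T$ with lockset $S$ at the sink, and put $$\gamma_{u,S}(W,P,\sigma)=\{t\in\mathcal T_S\mid\mathsf{loc}(t)=u,\ W_t\sqsubseteq W,\ P_t\sqsubseteq P,\ \sigma_t\subseteq\gamma_{\mathcal D}\circ\sigma\}.$$ Let $\gamma_{g,a,S,w}(d)$ be the set of all $t\in\mathcal T_S$ that are in $\mathsf{init}$ or end with $\mathsf{unlock}(a)$ and in which either there is no thread-local write to $g$, or the last one, $(\bar v,g=x,\bar v')$, writes a value in $\gamma_{\mathcal D}(d)$ and $L_t[\bar v']\subseteq w$. **Theorem.** Every post-solution $\eta_3$ of $\mathcal C_3$ is sound w.r.t. the local trace semantics, i.e.: 1. for all $u\in\mathcal N$ and $S\subseteq\mathsf M$, every $t\in\eta[u]$ with lockset $S$ at its sink is in $\gamma_{u,S}(\eta_3[u,S])$;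 2. for all $g\in\mathcal G$, $a\in\mathsf M$ and $S,w\subseteq\mathsf M$, every $t\in\eta[a]$ with lockset $S$ at its sink, in which either there is no thread-local write to $g$ or the last one, $(\bar v,g=x,\bar v')$, satisfies $L_t[\bar v']\subseteq w$, is in $\gamma_{g,a,S,w}\big(\bigsqcup\{\eta_3[g,a,S,w']\mid w'\subseteq w\}\big)$. -/

import Mathlib

universe u v

/-! ### Side-effecting constraint systems -/

/-- A constraint `lhs ⊒ rhs`: the right-hand side takes an assignment of the unknowns and returns
the side-effects to all unknowns together with the contribution to the left-hand side. -/
structure Constraint (Unk : Type u) (D : Unk → Type v) where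
  lhs : Unk
  rhs : (∀ x, D x) → (∀ x, D x) × D lhs

/-- (Post-)solutions: all side-effects and all contributions are accounted for. -/
def IsSolution {Unk : Type u} {D : Unk → Type v} [∀ x, LE (D x)]
    (C : Set (Constraint Unk D)) (η : ∀ x, D x) : Prop :=
  ∀ c ∈ C, (∀ x, (c.rhs η).1 x ≤ η x) ∧ (c.rhs η).2 ≤ η c.lhs

/-! ### Programs -/

/-- Actions over locals `X`, globals `G`, mutexes `M`, program points `N`, expressions `R`. -/
inductive Act (X G M N R : Type u) : Type u
  | guard (r : R)
  | assign (x : X) (r : R)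
  | create (x : X) (u₁ : N)
  | lock (a : M)
  | unlock (a : M)
  | read (x : X) (g : G)
  | write (g : G) (x : X)

/-- The local variable assigned by an action (if any). -/
def Act.target {X G M N R : Type u} : Act X G M N R → Option X
  | .assign x _ => some x
  | .create x _ => some x
  | .read x _ => some x
  | _ => none

/-- The action reads or writes the global `g`. -/
def Act.Accesses {X G M N R : Type u} (A : Act X G M N R) (g : G) : Prop :=
  (∃ x, A = .read x g) ∨ (∃ x, A = .write g x)

/-- The lockset after the action, when `S` is the lockset before. -/
def Act.lockset {X G M N R : Type u} (A : Act X G M N R) (S : Set M) : Set M :=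
  match A with
  | .lock a => S ∪ {a}
  | .unlock a => S \ {a}
  | _ => S

/-- A concurrent program, given by its control-flow edges. `V` is the set of values; `ff` is the
value denoting `false`, all other values are truthy; `mtx g` is the mutex `m_g`. -/
structure Program (X G V M N R : Type u) where
  self : X
  tids : Set V
  tid₀ : V
  tid₀_mem : tid₀ ∈ tids
  ff : V
  eval : R → (X → V) → V
  u₀ : N
  edges : Set (N × Act X G M N R × N)
  mtx : G → M

/-- The standing assumptions on programs. -/
structure Program.WellFormed {X G V M N R : Type u} (P : Program X G V M N R) : Prop where
  /-- `self` is never assigned explicitly -/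
  self_not_assigned : ∀ u A u', (u, A, u') ∈ P.edges → A.target ≠ some P.self
  /-- at each program point there is at most one edge that creates a thread -/
  create_unique : ∀ u x y u₁ u₂ v w, (u, .create x u₁, v) ∈ P.edges →
    (u, .create y u₂, w) ∈ P.edges → x = y ∧ u₁ = u₂ ∧ v = w
  /-- each access to `g` occurs as `lock(m_g); access; unlock(m_g)` -/
  access_not_start : ∀ g u A u', (u, A, u') ∈ P.edges → A.Accesses g →
    u ≠ P.u₀ ∧ ∀ v x v', (v, .create x u, v') ∉ P.edges
  access_locked : ∀ g u A u', (u, A, u') ∈ P.edges → A.Accesses g →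
    ∀ v B, (v, B, u) ∈ P.edges → B = .lock (P.mtx g)
  access_unlocked : ∀ g u A u', (u, A, u') ∈ P.edges → A.Accesses g →
    ∀ B v, (u', B, v) ∈ P.edges → B = .unlock (P.mtx g)

/-- Effect of an action on the local state; here an arbitrary value may be read from a global, and
an arbitrary thread id may be returned by `create`. -/
def Program.Step {X G V M N R : Type u} [DecidableEq X] (P : Program X G V M N R) :
    Act X G M N R → (X → V) → (X → V) → Prop
  | .guard r, σ, σ' => P.eval r σ ≠ P.ff ∧ σ' = σ
  | .assign x r, σ, σ' => σ' = Function.update σ x (P.eval r σ)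
  | .create x _, σ, σ' => ∃ i ∈ P.tids, σ' = Function.update σ x i
  | .lock _, σ, σ' => σ' = σ
  | .unlock _, σ, σ' => σ' = σ
  | .read x _, σ, σ' => ∃ d, σ' = Function.update σ x d
  | .write _ _, σ, σ' => σ' = σ

/-! ### Traces -/

/-- A node `(j, u, σ)` of a trace. -/
structure Node (X V N : Type u) where
  idx : ℕ
  pt : N
  st : X → V

/-- The raw trace `ū₀ a₁ ū₁ … aₙ ūₙ` of a single thread, `n = len`; `act j` leads from state `j` to
state `j + 1`, and entries beyond `len` are irrelevant. -/
structure RawTrace (X G V M N R : Type u) where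
  len : ℕ
  pt : ℕ → N
  st : ℕ → X → V
  act : ℕ → Act X G M N R

namespace RawTrace
variable {X G V M N R : Type u}

def node (l : RawTrace X G V M N R) (j : ℕ) : Node X V N := ⟨j, l.pt j, l.st j⟩

def nodes (l : RawTrace X G V M N R) : Set (Node X V N) := {v | ∃ j ≤ l.len, v = l.node j}

def edges (l : RawTrace X G V M N R) : Set (Node X V N × Act X G M N R × Node X V N) :=
  {e | ∃ j < l.len, e = (l.node j, l.act j, l.node (j + 1))}

/-- `l` is a raw trace of the thread `i` of the program `P`. -/
def IsRaw [DecidableEq X] (P : Program X G V M N R) (i : V) (l : RawTrace X G V M N R) : Prop :=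
  (∀ j ≤ l.len, l.st j P.self = i) ∧
  ∀ j < l.len, (l.pt j, l.act j, l.pt (j + 1)) ∈ P.edges ∧ P.Step (l.act j) (l.st j) (l.st (j + 1))

end RawTrace

/-- The data `(τ, →_c, (→_a)_a)` of a trace, with a distinguished node `sink`. -/
@[ext]
structure TraceGraph (X G V M N R : Type u) where
  nodes : Set (Node X V N)
  edges : Set (Node X V N × Act X G M N R × Node X V N)
  cr : Node X V N → Node X V N → Prop
  lk : M → Node X V N → Node X V N → Prop
  sink : Node X V N

namespace TraceGraph
variable {X G V M N R : Type u}

/-- The immediate causality relation: program order, create order and locking orders. -/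
def Succ (t : TraceGraph X G V M N R) (v v' : Node X V N) : Prop :=
  (∃ A, (v, A, v') ∈ t.edges) ∨ t.cr v v' ∨ ∃ a, t.lk a v v'

/-- The causality order. -/
def Le (t : TraceGraph X G V M N R) : Node X V N → Node X V N → Prop :=
  Relation.ReflTransGen t.Succ

/-- `a⁺`: nodes with an incoming edge `lock(a)`. -/
def acq (t : TraceGraph X G V M N R) (a : M) : Set (Node X V N) :=
  {v | ∃ z, (z, Act.lock a, v) ∈ t.edges}

/-- `a⁻`: nodes with an incoming edge `unlock(a)`. -/
def rel (t : TraceGraph X G V M N R) (a : M) : Set (Node X V N) :=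
  {v | ∃ z, (z, Act.unlock a, v) ∈ t.edges}

/-- Nodes that are minimal w.r.t. the program order. -/
def starts (t : TraceGraph X G V M N R) : Set (Node X V N) :=
  {v | v ∈ t.nodes ∧ ∀ z A, (z, A, v) ∉ t.edges}

/-- The mutex `a` has been acquired, and not yet been released, by the thread of the node. -/
inductive Holds (t : TraceGraph X G V M N R) (a : M) : Node X V N → Prop
  | acquire {z v} : (z, Act.lock a, v) ∈ t.edges → Holds t a v
  | keep {z A v} : (z, A, v) ∈ t.edges → A ≠ Act.unlock a → Holds t a z → Holds t a v

/-- The lockset `L_t[v]`. -/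
def lockset (t : TraceGraph X G V M N R) (v : Node X V N) : Set M := {a | t.Holds a v}

variable [DecidableEq X]

/-- The graph is a union of raw traces, one for each thread id in some set of thread ids. -/
def IsRawGlobal (P : Program X G V M N R) (t : TraceGraph X G V M N R) : Prop :=
  ∃ (I : Set V) (l : V → RawTrace X G V M N R), I ⊆ P.tids ∧ (∀ i ∈ I, (l i).IsRaw P i) ∧
    t.nodes = {v | ∃ i ∈ I, v ∈ (l i).nodes} ∧ t.edges = {e | ∃ i ∈ I, e ∈ (l i).edges}

/-- `t` is a global trace of `P` with least node `o`. -/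
structure IsGlobalTrace (P : Program X G V M N R) (t : TraceGraph X G V M N R) (o : Node X V N) :
    Prop where
  raw : t.IsRawGlobal P
  le_antisymm : ∀ v v', t.Le v v' → t.Le v' v → v = v'
  root_mem : o ∈ t.nodes
  root_idx : o.idx = 0
  root_pt : o.pt = P.u₀
  root_self : o.st P.self = P.tid₀
  root_le : ∀ v ∈ t.nodes, t.Le o v
  /-- Create order: a thread start other than the root is created from a node at whose program
  point there is a corresponding `create` edge. -/
  cr_dom : ∀ z s, t.cr z s → z ∈ t.nodes ∧ s ∈ t.starts ∧ s ≠ o ∧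
    ∃ x u', (z.pt, Act.create x s.pt, u') ∈ P.edges
  cr_pred : ∀ s ∈ t.starts, s ≠ o → ∃! z, t.cr z s
  cr_succ : ∀ z s s', t.cr z s → t.cr z s' → s = s'
  cr_state : ∀ z s, t.cr z s →
    s.idx = 0 ∧ ∃ i ∈ P.tids, s.st = Function.update z.st P.self i
  /-- If the creating thread proceeds beyond the creating node within `t`, then by the `create`
  action, and both threads agree on the id of the created thread. -/
  cr_agree : ∀ z s A z', t.cr z s → (z, A, z') ∈ t.edges →
    ∃ x, A = .create x s.pt ∧ z'.st x = s.st P.self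
  /-- Locking orders. -/
  lk_dom : ∀ a z y, t.lk a z y → (z ∈ t.rel a ∨ z = o) ∧ y ∈ t.acq a
  lk_pred : ∀ a, ∀ y ∈ t.acq a, ∃! z, t.lk a z y
  lk_succ : ∀ a z y y', t.lk a z y → t.lk a z y' → y = y'
  /-- Mutexes are not re-entrant and only released by a thread holding them. -/
  lock_free : ∀ a z y, (z, Act.lock a, y) ∈ t.edges → a ∉ t.lockset z
  unlock_held : ∀ a z y, (z, Act.unlock a, y) ∈ t.edges → a ∈ t.lockset z
  /-- Globals: the value read is the value of a maximal preceding write. -/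
  globals : ∀ v x g v', (v, Act.read x g, v') ∈ t.edges →
    ∃ z y z', (z, Act.write g y, z') ∈ t.edges ∧ t.Le z' v ∧
      (∀ z₂ y₂ z₂', (z₂, Act.write g y₂, z₂') ∈ t.edges → t.Le z₂' v → t.Le z' z₂' → z₂' = z') ∧
      v'.st x = z.st y

/-- A local trace is a global trace whose causality order has the greatest element `sink`. -/
def IsLocalTrace (P : Program X G V M N R) (t : TraceGraph X G V M N R) : Prop :=
  (∃ o, t.IsGlobalTrace P o) ∧ t.sink ∈ t.nodes ∧ ∀ v ∈ t.nodes, t.Le v t.sink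

/-- The one-node graph `0_σ`. -/
def start (P : Program X G V M N R) (σ : X → V) : TraceGraph X G V M N R where
  nodes := {⟨0, P.u₀, σ⟩}
  edges := ∅
  cr := fun _ _ => False
  lk := fun _ _ _ => False
  sink := ⟨0, P.u₀, σ⟩

/-- Prolong the ego thread by the action `A`, reaching point `u'` with local state `σ'`. -/
def extend (t : TraceGraph X G V M N R) (A : Act X G M N R) (u' : N) (σ' : X → V) :
    TraceGraph X G V M N R where
  nodes := insert ⟨t.sink.idx + 1, u', σ'⟩ t.nodes
  edges := insert (t.sink, A, ⟨t.sink.idx + 1, u', σ'⟩) t.edges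
  cr := t.cr
  lk := t.lk
  sink := ⟨t.sink.idx + 1, u', σ'⟩

/-- Merge `t₀` and `t₁` and prolong the ego thread of `t₀` by `lock(a)`, where `a` is taken over from
the sink of `t₁`. -/
def extendLock (t₀ t₁ : TraceGraph X G V M N R) (a : M) (u' : N) : TraceGraph X G V M N R where
  nodes := insert ⟨t₀.sink.idx + 1, u', t₀.sink.st⟩ (t₀.nodes ∪ t₁.nodes)
  edges := insert (t₀.sink, .lock a, ⟨t₀.sink.idx + 1, u', t₀.sink.st⟩) (t₀.edges ∪ t₁.edges)
  cr := fun z s => t₀.cr z s ∨ t₁.cr z s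
  lk := fun b z y => t₀.lk b z y ∨ t₁.lk b z y ∨
    (b = a ∧ z = t₁.sink ∧ y = ⟨t₀.sink.idx + 1, u', t₀.sink.st⟩)
  sink := ⟨t₀.sink.idx + 1, u', t₀.sink.st⟩

/-- Start a new thread with id `i` at point `u₁` from the sink of `t`. -/
def extendNew (P : Program X G V M N R) (t : TraceGraph X G V M N R) (u₁ : N) (i : V) :
    TraceGraph X G V M N R where
  nodes := insert ⟨0, u₁, Function.update t.sink.st P.self i⟩ t.nodes
  edges := t.edges
  cr := fun z s => t.cr z s ∨ (z = t.sink ∧ s = ⟨0, u₁, Function.update t.sink.st P.self i⟩)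
  lk := t.lk
  sink := ⟨0, u₁, Function.update t.sink.st P.self i⟩

end TraceGraph

/-- The type of local traces of `P`. -/
def LocalTrace {X G V M N R : Type u} [DecidableEq X] (P : Program X G V M N R) : Type u :=
  {t : TraceGraph X G V M N R // t.IsLocalTrace P}

namespace LocalTrace
variable {X G V M N R : Type u} [DecidableEq X] {P : Program X G V M N R}

/-- The program point of the sink. -/
def loc (t : LocalTrace P) : N := t.1.sink.pt

/-- The thread id of the ego thread. -/
def id (t : LocalTrace P) : V := t.1.sink.st P.self

/-- The last action of the ego thread is `A`. -/
def LastIs (t : LocalTrace P) (A : Act X G M N R) : Prop := ∃ z, (z, A, t.1.sink) ∈ t.1.edges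

/-- The lockset at the sink. -/
def locks (t : LocalTrace P) : Set M := t.1.lockset t.1.sink

/-- The initial local traces. -/
def init (P : Program X G V M N R) : Set (LocalTrace P) :=
  {t | ∃ σ : X → V, σ P.self = P.tid₀ ∧ t.1 = TraceGraph.start P σ}

/-- `new u₁ t`, where `ν` provides the id of the created thread. -/
def new (ν : LocalTrace P → P.tids) (u₁ : N) (t : LocalTrace P) : Set (LocalTrace P) :=
  {t₁ | (∃ x u', (t.loc, Act.create x u₁, u') ∈ P.edges) ∧ t₁.1 = t.1.extendNew P u₁ (ν t)}

/-- The semantics of an edge `(u, A, u')` where `A` is not a lock operation. -/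
def sem (ν : LocalTrace P → P.tids) (u : N) (A : Act X G M N R) (u' : N) (t₀ : LocalTrace P) :
    Set (LocalTrace P) :=
  {t | t₀.loc = u ∧ ∃ σ', t.1 = t₀.1.extend A u' σ' ∧ ∀ x u₁, A = .create x u₁ → σ' x = ν t₀}

/-- The semantics of an edge `(u, lock(a), u')`. -/
def semLock (u : N) (a : M) (u' : N) (t₀ t₁ : LocalTrace P) : Set (LocalTrace P) :=
  {t | t₀.loc = u ∧ (t₁ ∈ init P ∨ t₁.LastIs (.unlock a)) ∧ t.1 = t₀.1.extendLock t₁.1 a u'}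

/-- The least set `𝒯` of local traces that contains `init` and is closed under `new` and the
semantics of all control-flow edges. -/
inductive Reachable (ν : LocalTrace P → P.tids) : LocalTrace P → Prop
  | init {t} : t ∈ init P → Reachable ν t
  | new {u₁ t t₁} : Reachable ν t → t₁ ∈ new ν u₁ t → Reachable ν t₁
  | step {u A u' t₀ t} : (u, A, u') ∈ P.edges → (∀ a, A ≠ .lock a) → Reachable ν t₀ →
      t ∈ sem ν u A u' t₀ → Reachable ν t
  | lock {u a u' t₀ t₁ t} : (u, .lock a, u') ∈ P.edges → Reachable ν t₀ → Reachable ν t₁ →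
      t ∈ semLock u a u' t₀ t₁ → Reachable ν t

/-- `𝒯_S`: the local traces in `𝒯` with lockset `S` at the sink. -/
def withLocks (ν : LocalTrace P → P.tids) (S : Set M) : Set (LocalTrace P) :=
  {t | Reachable ν t ∧ t.locks = S}

/-- `last_tl_write_g t = (v, g = x, v')`. -/
def LastTlWrite (t : LocalTrace P) (g : G) (v : Node X V N) (x : X) (v' : Node X V N) : Prop :=
  (v, Act.write g x, v') ∈ t.1.edges ∧ v.st P.self = t.id ∧
    ∀ z y z', (z, Act.write g y, z') ∈ t.1.edges → z.st P.self = t.id → z'.idx ≤ v'.idx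

/-- `last_tl_write_g t = ⊥`. -/
def NoTlWrite (t : LocalTrace P) (g : G) : Prop :=
  ∀ z y z', (z, Act.write g y, z') ∈ t.1.edges → z.st P.self ≠ t.id

end LocalTrace

/-! ### The concrete local constraint system -/

inductive ConcUnk (M N : Type u) : Type u
  | pt (u : N)
  | mx (a : M)

section Concrete
variable {X G V M N R : Type u} [DecidableEq X] {P : Program X G V M N R}
open LocalTrace

/-- Right-hand side for the edge `(u, A, u')`. -/
def concRhs (ν : LocalTrace P → P.tids) (u : N) (A : Act X G M N R) (u' : N)
    (η : ConcUnk M N → Set (LocalTrace P)) :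
    (ConcUnk M N → Set (LocalTrace P)) × Set (LocalTrace P) :=
  match A with
  | .create x u₁ =>
    (fun
      | .pt v => {t | v = u₁ ∧ ∃ t₀ ∈ η (.pt u), t ∈ new ν u₁ t₀}
      | .mx _ => ∅,
     {t | ∃ t₀ ∈ η (.pt u), t ∈ sem ν u (.create x u₁) u' t₀})
  | .lock a =>
    (fun _ => ∅, {t | ∃ t₀ ∈ η (.pt u), ∃ t₁ ∈ η (.mx a), t ∈ semLock u a u' t₀ t₁})
  | .unlock a =>
    (fun
      | .pt _ => ∅
      | .mx b => {t | b = a ∧ ∃ t₀ ∈ η (.pt u), t ∈ sem ν u (.unlock a) u' t₀},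
     {t | ∃ t₀ ∈ η (.pt u), t ∈ sem ν u (.unlock a) u' t₀})
  | A => (fun _ => ∅, {t | ∃ t₀ ∈ η (.pt u), t ∈ sem ν u A u' t₀})

/-- The local constraint system `𝒞` of the trace semantics. -/
def concSystem (ν : LocalTrace P → P.tids) :
    Set (Constraint (ConcUnk M N) (fun _ => Set (LocalTrace P))) :=
  {⟨.pt P.u₀, fun _ => (fun _ => ∅, init P)⟩} ∪
  {c | ∃ a : M, c = ⟨.mx a, fun _ => (fun _ => ∅, init P)⟩} ∪
  {c | ∃ u A u', (u, A, u') ∈ P.edges ∧ c = ⟨.pt u', concRhs ν u A u'⟩}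

end Concrete

/-! ### Write-Centered Reading -/

/-- `𝒰_M`: upward-closed sets of locksets, ordered by inclusion (Mathlib orders `UpperSet` by
reverse inclusion, whence the order dual). -/
abbrev UpLocks (M : Type u) : Type u := (UpperSet (Set M))ᵒᵈ

namespace UpLocks
variable {M : Type u}

/-- The element represented by `{S}`. -/
def single (S : Set M) : UpLocks M := OrderDual.toDual (UpperSet.Ici S)

/-- The locksets in an upward-closed set. -/
def sets (U : UpLocks M) : Set (Set M) := (OrderDual.ofDual U : UpperSet (Set M))

/-- The minimal elements, which represent an upward-closed set. -/
def mins (U : UpLocks M) : Set (Set M) := {S | Minimal (· ∈ U.sets) S}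

/-- The upward closure of a set of locksets. -/
def closure (B : Set (Set M)) : UpLocks M := OrderDual.toDual (upperClosure B)

end UpLocks

/-- Abstract local states `(W, P, σ)`. -/
abbrev AbsState (X G M D : Type u) : Type u := (G → UpLocks M) × (G → UpLocks M) × (X ⊕ G → D)

/-- Unknowns `[u, S]` and `[g, a, S, w]`. -/
inductive AbsUnk (G M N : Type u) : Type u
  | pt (u : N) (S : Set M)
  | glob (g : G) (a : M) (S w : Set M)

/-- The lattice of values of an unknown. -/
def AbsVal (X G M N D : Type u) : AbsUnk G M N → Type u
  | .pt _ _ => AbsState X G M D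
  | .glob _ _ _ _ => D

instance AbsVal.instCompleteLattice {X G M N D : Type u} [CompleteLattice D] :
    (x : AbsUnk G M N) → CompleteLattice (AbsVal X G M N D x)
  | .pt _ _ => inferInstanceAs (CompleteLattice (AbsState X G M D))
  | .glob _ _ _ _ => inferInstanceAs (CompleteLattice D)

/-- The parameters of the analysis: the concretization `γ_D` of abstract values, the abstract thread
id `ν♯`, and the transfer functions for guards and for computations on locals. -/
structure AbsDomain (X G V M N R D : Type u) where
  γ : D → Set V
  νs : N → AbsState X G M D → N → D
  guardT : R → (X ⊕ G → D) → (X ⊕ G → D)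
  assignT : X → R → (X ⊕ G → D) → (X ⊕ G → D)

section Analysis
variable {X G V M N R D : Type u} [DecidableEq X] [DecidableEq G] [CompleteLattice D]

/-- The right-hand side for the edge `(u, A, u')` and the lockset `S`. -/
def absRhs (P : Program X G V M N R) (Dm : AbsDomain X G V M N R D) (u : N) (S : Set M)
    (A : Act X G M N R) (η : ∀ x, AbsVal X G M N D x) :
    (∀ x, AbsVal X G M N D x) × AbsState X G M D :=
  let s : AbsState X G M D := η (.pt u S)
  let W := s.1
  let Q := s.2.1
  let σ := s.2.2
  match A with
  | .guard r => (⊥, (W, Q, Dm.guardT r σ))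
  | .assign x r => (⊥, (W, Q, Dm.assignT x r σ))
  | .create x u₁ =>
    let i := Dm.νs u (W, Q, σ) u₁
    let σ' : X ⊕ G → D :=
      Sum.elim (Function.update (fun y => σ (.inl y)) P.self i) (fun _ => ⊥)
    let s' : AbsState X G M D := (fun _ => ⊥, fun _ => UpLocks.single ∅, σ')
    (fun
      | .pt v T => (⨆ _ : v = u₁ ∧ T = ∅, s' : AbsState X G M D)
      | .glob _ _ _ _ => (⊥ : D),
     (W, Q, Function.update σ (.inl x) i))
  | .lock _ => (⊥, (W, Q, σ))
  | .unlock a =>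
    (fun
      | .pt _ _ => (⊥ : AbsState X G M D)
      | .glob g b T w => (⨆ _ : b = a ∧ T = S \ {a} ∧ w ∈ (W g).mins, σ (.inr g) : D),
     (W, fun g => Q g ⊔ UpLocks.single (S \ {a}), σ))
  | .write g x =>
    (⊥, (Function.update W g (UpLocks.single S), Function.update Q g (UpLocks.single S),
      Function.update σ (.inr g) (σ (.inl x))))
  | .read x g =>
    let d : D := σ (.inr g) ⊔
      sSup {d | ∃ a S' w, a ∈ S ∧ S ∩ S' = ∅ ∧ (∃ S'' ∈ (Q g).mins, S'' ∩ w = ∅) ∧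
        (∃ S''' ∈ (Q g).mins, a ∉ S''') ∧ d = η (.glob g a S' w)}
    (⊥, (W, Q, Function.update σ (.inl x) d))

/-- The constraint system `𝒞₃` of Write-Centered Reading. -/
def absSystem (P : Program X G V M N R) (Dm : AbsDomain X G V M N R D) :
    Set (Constraint (AbsUnk G M N) (AbsVal X G M N D)) :=
  {⟨.pt P.u₀ ∅, fun _ => (⊥, ((fun _ => ⊥, fun _ => UpLocks.single ∅,
      Sum.elim (fun _ => ⊤) (fun _ => ⊥)) : AbsState X G M D))⟩} ∪
  {c | ∃ u A u' S, (u, A, u') ∈ P.edges ∧ c = ⟨.pt u' (A.lockset S), absRhs P Dm u S A⟩}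

end Analysis

/-! ### Soundness -/

section Soundness
variable {X G V M N R D : Type u} [DecidableEq X] {P : Program X G V M N R}
open LocalTrace

/-- The locksets held by the ego thread since the node `v'` of the ego thread. -/
def LocalTrace.minLocksetSince (t : LocalTrace P) (v' : Node X V N) : UpLocks M :=
  UpLocks.closure {L | ∃ y ∈ t.1.nodes, y.st P.self = t.id ∧ v'.idx ≤ y.idx ∧ L = t.1.lockset y}

/-- The `W`-component of the abstraction `β t` (empty if there is no thread-local write to `g`). -/
def LocalTrace.betaW (t : LocalTrace P) (g : G) : UpLocks M :=
  UpLocks.closure {L | ∃ v x v', t.LastTlWrite g v x v' ∧ L = t.1.lockset v'}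

/-- The `P`-component of the abstraction `β t`. -/
def LocalTrace.betaP (t : LocalTrace P) (g : G) : UpLocks M :=
  UpLocks.closure {L | (t.NoTlWrite g ∧ L = ∅) ∨
    ∃ v x v', t.LastTlWrite g v x v' ∧ L ∈ (t.minLocksetSince v').sets}

/-- The `σ`-component of the abstraction `β t`: the values of the locals at the sink and the values
of the last thread-local writes to globals. -/
def LocalTrace.betaVal (t : LocalTrace P) : X ⊕ G → Set V
  | .inl x => {t.1.sink.st x}
  | .inr g => {d | ∃ v x v', t.LastTlWrite g v x v' ∧ d = v.st x}

/-- The concretization `γ_{u,S}`. -/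
def gammaPt (ν : LocalTrace P → P.tids) (γ : D → Set V) (u : N) (S : Set M)
    (s : AbsState X G M D) : Set (LocalTrace P) :=
  {t | t ∈ withLocks ν S ∧ t.loc = u ∧ (∀ g, t.betaW g ≤ s.1 g) ∧ (∀ g, t.betaP g ≤ s.2.1 g) ∧
    ∀ y, t.betaVal y ⊆ γ (s.2.2 y)}

/-- The concretization `γ_{g,a,S,w}`. -/
def gammaGlob (ν : LocalTrace P → P.tids) (γ : D → Set V) (g : G) (a : M) (S w : Set M) (d : D) :
    Set (LocalTrace P) :=
  {t | t ∈ withLocks ν S ∧ (t ∈ init P ∨ t.LastIs (.unlock a)) ∧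
    ((∃ v x v', t.LastTlWrite g v x v' ∧ v.st x ∈ γ d ∧ t.1.lockset v' ⊆ w) ∨ t.NoTlWrite g)}

/-- `split[η] [u, S]`. -/
def splitPt (η : ConcUnk M N → Set (LocalTrace P)) (u : N) (S : Set M) : Set (LocalTrace P) :=
  η (.pt u) ∩ {t | t.locks = S}

/-- `split[η] [g, a, S, w]`. -/
def splitGlob (η : ConcUnk M N → Set (LocalTrace P)) (g : G) (a : M) (S w : Set M) :
    Set (LocalTrace P) :=
  η (.mx a) ∩ {t | t.locks = S ∧
    ((∃ v x v', t.LastTlWrite g v x v' ∧ t.1.lockset v' ⊆ w) ∨ t.NoTlWrite g)}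

/-- The assumptions on the parameters of the analysis: `γ_D` is monotone with `γ_D ⊤` everything,
`ν♯` describes the ids of created threads, and the transfer functions for guards and for assignments
to locals describe the effect on the locals and keep (a superset of) the values of the globals. -/
structure AbsDomain.Admissible [CompleteLattice D] (Dm : AbsDomain X G V M N R D)
    (ν : LocalTrace P → P.tids) : Prop where
  γ_mono : Monotone Dm.γ
  γ_top : Dm.γ ⊤ = Set.univ
  νs_spec : ∀ u S s x u₁ u' t, (u, Act.create x u₁, u') ∈ P.edges →
    t ∈ gammaPt ν Dm.γ u S s → (ν t : V) ∈ Dm.γ (Dm.νs u s u₁)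
  guardT_spec : ∀ r (σ : X → V) (ρ : G → Set V) (σs : X ⊕ G → D), P.eval r σ ≠ P.ff →
    (∀ x, σ x ∈ Dm.γ (σs (.inl x))) → (∀ g, ρ g ⊆ Dm.γ (σs (.inr g))) →
    (∀ x, σ x ∈ Dm.γ (Dm.guardT r σs (.inl x))) ∧ ∀ g, ρ g ⊆ Dm.γ (Dm.guardT r σs (.inr g))
  assignT_spec : ∀ y r (σ : X → V) (ρ : G → Set V) (σs : X ⊕ G → D),
    (∀ x, σ x ∈ Dm.γ (σs (.inl x))) → (∀ g, ρ g ⊆ Dm.γ (σs (.inr g))) →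
    (∀ x, Function.update σ y (P.eval r σ) x ∈ Dm.γ (Dm.assignT y r σs (.inl x))) ∧
      ∀ g, ρ g ⊆ Dm.γ (Dm.assignT y r σs (.inr g))

end Soundness

/-!
Every reachable local trace is described by `η₃`, by induction on its construction; the invariant is
carried along for all subtraces that end at earlier nodes. The one hard step is a read of `g` that
sees the write of another thread. Both threads hold the mutex `m_g` at their accesses, so some chain
of mutex hand-overs leads from the write to the read. Among the releases by the writer's thread,
after the write and causally before the read, of mutexes held at the read, take the last one, of
`a`, say. Any other mutex held both then and at the read would have to be released later, so the two
locksets are disjoint, and the subtrace ending at this release has contributed the value read to an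
unknown `[g, a, S', w]`. The last write of the reader to `g`, if any, precedes the foreign one.
Mutual exclusion, applied from the reader to the writer, therefore shows that since its own write
the reader has held some lockset disjoint from that of the foreign write and has at some moment not
held `a`; these are the conditions that the analysis imposes on `P g`.
-/

/-! ### Upward-closed sets of locksets -/

namespace UpLocks
variable {M : Type u} {U : UpLocks M} {S T : Set M}

theorem mem_sets_of_subset (h : S ⊆ T) (hS : S ∈ U.sets) : T ∈ U.sets :=
  (OrderDual.ofDual U : UpperSet (Set M)).upper h hS

theorem closure_le {B : Set (Set M)} : closure B ≤ U ↔ B ⊆ U.sets :=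
  le_upperClosure

theorem single_le : single S ≤ U ↔ S ∈ U.sets :=
  UpperSet.le_Ici

theorem mem_single_self : S ∈ (single S).sets :=
  single_le.1 le_rfl

theorem exists_mins_subset (hfin : S.Finite) (hS : S ∈ U.sets) : ∃ T ∈ U.mins, T ⊆ S := by
  obtain ⟨T, hTS, hT⟩ := (hfin.finite_subsets.subset
    fun _ h => h.2 : {T | T ∈ U.sets ∧ T ⊆ S}.Finite).exists_le_minimal ⟨hS, subset_rfl⟩
  exact ⟨T, ⟨hT.prop.1, fun T' hT' hle => hT.le_of_le ⟨hT', hle.trans hTS⟩ hle⟩, hTS⟩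

end UpLocks

/-! ### The program order -/

section ProgramOrder
variable {X G V M N R : Type u} {P : Program X G V M N R} {u v w : Node X V N}

/-- The reflexive program order: `v` and `v'` belong to the same thread, and `v'` is not before `v`.
It is expressed by the indices because a node of a trace is determined by its thread and index. -/
structure Node.ProgLe (P : Program X G V M N R) (v v' : Node X V N) : Prop where
  self_eq : v.st P.self = v'.st P.self
  idx_le : v.idx ≤ v'.idx

/-- The strict program order: `v` and `v'` belong to the same thread, and `v` is before `v'`. -/
structure Node.ProgLt (P : Program X G V M N R) (v v' : Node X V N) : Prop where
  self_eq : v.st P.self = v'.st P.self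
  idx_lt : v.idx < v'.idx

namespace Node

theorem ProgLe.refl (v : Node X V N) : v.ProgLe P v := ⟨rfl, le_rfl⟩

theorem ProgLe.trans (h : u.ProgLe P v) (h' : v.ProgLe P w) : u.ProgLe P w :=
  ⟨h.self_eq.trans h'.self_eq, h.idx_le.trans h'.idx_le⟩

theorem ProgLt.le (h : v.ProgLt P w) : v.ProgLe P w := ⟨h.self_eq, h.idx_lt.le⟩

theorem ProgLe.trans_lt (h : u.ProgLe P v) (h' : v.ProgLt P w) : u.ProgLt P w :=
  ⟨h.self_eq.trans h'.self_eq, h.idx_le.trans_lt h'.idx_lt⟩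

theorem ProgLt.trans (h : u.ProgLt P v) (h' : v.ProgLt P w) : u.ProgLt P w :=
  h.le.trans_lt h'

theorem progLe_or_progLt (h : v.st P.self = w.st P.self) : v.ProgLe P w ∨ w.ProgLt P v :=
  (le_or_gt v.idx w.idx).imp (⟨h, ·⟩) (⟨h.symm, ·⟩)

end Node
end ProgramOrder

/-! ### Threads and locksets -/

theorem Act.finite_lockset {X G M N R : Type u} (A : Act X G M N R) {S : Set M} (hS : S.Finite) :
    (A.lockset S).Finite := by
  cases A with
  | lock a => exact hS.union (Set.finite_singleton a)
  | unlock a => exact hS.sdiff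
  | _ => exact hS

namespace TraceGraph
variable {X G V M N R : Type u} {P : Program X G V M N R} {t : TraceGraph X G V M N R}

theorem le_of_lk {a z y} (e : t.lk a z y) : t.Le z y :=
  Relation.ReflTransGen.single (Or.inr (Or.inr ⟨a, e⟩))

section Threads
variable [DecidableEq X]

namespace IsRawGlobal
variable {z v v' : Node X V N} {A : Act X G M N R} {a : M}

theorem exists_rawTrace_of_mem_edges (h : t.IsRawGlobal P) (e : (z, A, v) ∈ t.edges) :
    ∃ i, ∃ l : RawTrace X G V M N R, l.IsRaw P i ∧ l.nodes ⊆ t.nodes ∧ (z, A, v) ∈ l.edges := by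
  obtain ⟨I, l, -, hl, hn, he⟩ := h
  rw [he] at e
  obtain ⟨i, hi, e⟩ := e
  exact ⟨i, l i, hl i hi, fun n hv => hn ▸ ⟨i, hi, hv⟩, e⟩

theorem source_mem (h : t.IsRawGlobal P) (e : (z, A, v) ∈ t.edges) : z ∈ t.nodes := by
  obtain ⟨_, l, -, hn, j, hj, ⟨⟩⟩ := h.exists_rawTrace_of_mem_edges e
  exact hn ⟨j, hj.le, rfl⟩

theorem target_mem (h : t.IsRawGlobal P) (e : (z, A, v) ∈ t.edges) : v ∈ t.nodes := by
  obtain ⟨_, l, -, hn, j, hj, ⟨⟩⟩ := h.exists_rawTrace_of_mem_edges e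
  exact hn ⟨j + 1, hj, rfl⟩

theorem idx_succ (h : t.IsRawGlobal P) (e : (z, A, v) ∈ t.edges) : v.idx = z.idx + 1 := by
  obtain ⟨_, l, -, -, j, -, ⟨⟩⟩ := h.exists_rawTrace_of_mem_edges e
  rfl

theorem self_eq (h : t.IsRawGlobal P) (e : (z, A, v) ∈ t.edges) :
    v.st P.self = z.st P.self := by
  obtain ⟨_, l, hl, -, j, hj, ⟨⟩⟩ := h.exists_rawTrace_of_mem_edges e
  exact (hl.1 _ hj).trans (hl.1 _ hj.le).symm

theorem cfg_edge (h : t.IsRawGlobal P) (e : (z, A, v) ∈ t.edges) :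
    (z.pt, A, v.pt) ∈ P.edges := by
  obtain ⟨_, l, hl, -, j, hj, ⟨⟩⟩ := h.exists_rawTrace_of_mem_edges e
  exact (hl.2 j hj).1

theorem step (h : t.IsRawGlobal P) (e : (z, A, v) ∈ t.edges) : P.Step A z.st v.st := by
  obtain ⟨_, l, hl, -, j, hj, ⟨⟩⟩ := h.exists_rawTrace_of_mem_edges e
  exact (hl.2 j hj).2

theorem progLt_of_edge (h : t.IsRawGlobal P) (e : (z, A, v) ∈ t.edges) : z.ProgLt P v :=
  ⟨(h.self_eq e).symm, (Nat.lt_succ_self _).trans_eq (h.idx_succ e).symm⟩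

theorem progLe_of_edge_of_progLt (h : t.IsRawGlobal P) (e : (z, A, v) ∈ t.edges)
    (hv : v'.ProgLt P v) : v'.ProgLe P z :=
  ⟨hv.self_eq.trans (h.self_eq e), Nat.le_of_lt_succ (hv.idx_lt.trans_eq (h.idx_succ e))⟩

theorem node_ext (h : t.IsRawGlobal P) (hv : v ∈ t.nodes) (hv' : v' ∈ t.nodes)
    (hs : v.st P.self = v'.st P.self) (hi : v.idx = v'.idx) : v = v' := by
  obtain ⟨I, l, -, hl, hn, -⟩ := h
  rw [hn] at hv hv'
  obtain ⟨i, hiI, j, hj, rfl⟩ := hv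
  obtain ⟨i', hiI', j', hj', rfl⟩ := hv'
  obtain rfl : j = j' := hi
  obtain rfl : i = i' := ((hl i hiI).1 _ hj).symm.trans (hs.trans ((hl i' hiI').1 _ hj'))
  rfl

theorem eq_of_progLe_of_progLe (h : t.IsRawGlobal P) (hv : v ∈ t.nodes) (hv' : v' ∈ t.nodes)
    (hle : v.ProgLe P v') (hge : v'.ProgLe P v) : v = v' :=
  h.node_ext hv hv' hle.self_eq (hle.idx_le.antisymm hge.idx_le)

theorem exists_pred (h : t.IsRawGlobal P) (hv : v ∈ t.nodes) (h0 : v.idx ≠ 0) :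
    ∃ z A, (z, A, v) ∈ t.edges := by
  obtain ⟨I, l, -, hl, hn, he⟩ := h
  rw [hn] at hv
  obtain ⟨i, hi, j, hj, rfl⟩ := hv
  obtain ⟨k, rfl⟩ := Nat.exists_eq_succ_of_ne_zero (show j ≠ 0 from h0)
  exact ⟨(l i).node k, (l i).act k, he ▸ ⟨i, hi, k, hj, rfl⟩⟩

theorem pred_unique (h : t.IsRawGlobal P) {z' A'} (e : (z, A, v) ∈ t.edges)
    (e' : (z', A', v) ∈ t.edges) : z = z' ∧ A = A' := by
  obtain ⟨I, l, -, hl, -, he⟩ := h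
  rw [he] at e e'
  obtain ⟨i, hi, j, hj, ⟨⟩⟩ := e
  obtain ⟨i', hi', j', hj', e'⟩ := e'
  obtain ⟨rfl, rfl, hnode⟩ := by simpa only [Prod.mk.injEq] using e'
  obtain rfl : j = j' := Nat.succ_injective (congrArg Node.idx hnode)
  obtain rfl : i = i' := ((hl i hi).1 _ hj).symm.trans
    ((congrArg (fun n => n.st P.self) hnode).trans ((hl i' hi').1 _ hj'))
  exact ⟨rfl, rfl⟩

theorem exists_node (h : t.IsRawGlobal P) (hv : v ∈ t.nodes) {k : ℕ} (hk : k ≤ v.idx) :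
    ∃ z ∈ t.nodes, z.st P.self = v.st P.self ∧ z.idx = k := by
  obtain ⟨I, l, -, hl, hn, he⟩ := h
  rw [hn] at hv ⊢
  obtain ⟨i, hi, j, hj, rfl⟩ := hv
  have hk' : k ≤ (l i).len := hk.trans hj
  exact ⟨(l i).node k, ⟨i, hi, k, hk', rfl⟩, ((hl i hi).1 _ hk').trans ((hl i hi).1 _ hj).symm, rfl⟩

theorem le_of_progLe (h : t.IsRawGlobal P) (hv : v ∈ t.nodes) (hv' : v' ∈ t.nodes)
    (hle : v.ProgLe P v') : t.Le v v' := by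
  obtain ⟨d, hd⟩ := Nat.exists_eq_add_of_le hle.idx_le
  induction d generalizing v' with
  | zero => exact h.node_ext hv hv' hle.self_eq hd.symm ▸ Relation.ReflTransGen.refl
  | succ d ih =>
    obtain ⟨z, A, e⟩ := h.exists_pred hv' (by omega)
    have hz := h.idx_succ e
    exact (ih (h.source_mem e) ⟨hle.self_eq.trans (h.self_eq e), by omega⟩ (by omega)).tail
      (Or.inl ⟨A, e⟩)

theorem mem_nodes_of_holds (h : t.IsRawGlobal P) (hv : t.Holds a v) : v ∈ t.nodes := by
  cases hv with
  | acquire e => exact h.target_mem e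
  | keep e => exact h.target_mem e

theorem mem_nodes_of_mem_acq (h : t.IsRawGlobal P) (hv : v ∈ t.acq a) : v ∈ t.nodes :=
  hv.elim fun _ => h.target_mem

theorem mem_nodes_of_mem_rel (h : t.IsRawGlobal P) (hv : v ∈ t.rel a) : v ∈ t.nodes :=
  hv.elim fun _ => h.target_mem

theorem lockset_edge (h : t.IsRawGlobal P) (e : (z, A, v) ∈ t.edges) :
    t.lockset v = A.lockset (t.lockset z) := by
  have holds_iff (b) : t.Holds b v ↔ A = .lock b ∨ A ≠ .unlock b ∧ t.Holds b z := by
    constructor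
    · intro hb
      cases hb with
      | acquire e' => exact Or.inl (h.pred_unique e e').2
      | keep e' hA hz =>
        obtain ⟨rfl, rfl⟩ := h.pred_unique e e'
        exact Or.inr ⟨hA, hz⟩
    · rintro (rfl | ⟨hA, hz⟩)
      · exact .acquire e
      · exact .keep e hA hz
  ext b
  refine (holds_iff b).trans ?_
  cases A <;> simp [Act.lockset, lockset, eq_comm, and_comm]

theorem not_holds_of_mem_rel (h : t.IsRawGlobal P) (hv : v ∈ t.rel a) : ¬ t.Holds a v := by
  obtain ⟨z, e⟩ := hv
  exact fun ha => ((h.lockset_edge e).subset ha).2 rfl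

theorem lockset_of_idx_zero (h : t.IsRawGlobal P) (h0 : v.idx = 0) : t.lockset v = ∅ := by
  refine Set.eq_empty_of_forall_notMem fun b hb => ?_
  cases hb with
  | acquire e => exact absurd (h.idx_succ e) (by omega)
  | keep e => exact absurd (h.idx_succ e) (by omega)

theorem finite_lockset (h : t.IsRawGlobal P) (hv : v ∈ t.nodes) : (t.lockset v).Finite := by
  induction hi : v.idx generalizing v with
  | zero => exact h.lockset_of_idx_zero hi ▸ Set.finite_empty
  | succ n ih =>
    obtain ⟨z, A, e⟩ := h.exists_pred hv (by omega)
    exact h.lockset_edge e ▸ A.finite_lockset (ih (h.source_mem e) (by have := h.idx_succ e; omega))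

end IsRawGlobal
end Threads

/-! ### Mutual exclusion -/

/-- The thread of `n` acquires the mutex `a` at the node `q` and holds it from there up to `n`. -/
structure HeldSince (P : Program X G V M N R) (t : TraceGraph X G V M N R) (a : M)
    (q n : Node X V N) : Prop where
  mem_acq : q ∈ t.acq a
  progLe : q.ProgLe P n
  holds : ∀ m ∈ t.nodes, q.ProgLe P m → m.ProgLe P n → t.Holds a m

/-- The release `r` of the mutex `a` that ends the critical section started by the acquisition
`q`. -/
def Releases (P : Program X G V M N R) (t : TraceGraph X G V M N R) (a : M)
    (q r : Node X V N) : Prop :=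
  ∃ z, (z, Act.unlock a, r) ∈ t.edges ∧ HeldSince P t a q z

/-- `q'` takes over the mutex `a` from the critical section started by the acquisition `q`. -/
def NextAcq (P : Program X G V M N R) (t : TraceGraph X G V M N R) (a : M)
    (q q' : Node X V N) : Prop :=
  ∃ r, Releases P t a q r ∧ t.lk a r q'

/-- After `m`, its thread releases the mutex `a`, and causally after that release, but not after
`n`, the thread of `n` acquires `a`. -/
def HandsOver (P : Program X G V M N R) (t : TraceGraph X G V M N R) (a : M)
    (m n : Node X V N) : Prop :=
  ∃ r ∈ t.rel a, ∃ q ∈ t.acq a, m.ProgLt P r ∧ t.Le r q ∧ q.ProgLe P n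

theorem Releases.mem_rel {a : M} {q r : Node X V N} (h : Releases P t a q r) : r ∈ t.rel a :=
  h.imp fun _ hz => hz.1

variable [DecidableEq X]

namespace IsRawGlobal
variable {a : M} {m n q q' r r' : Node X V N}

theorem exists_heldSince (h : t.IsRawGlobal P) (hn : t.Holds a n) :
    ∃ q, HeldSince P t a q n := by
  induction hn with
  | @acquire z v e =>
    refine ⟨v, ⟨z, e⟩, .refl v, fun m hm hvm hmv => ?_⟩
    exact h.eq_of_progLe_of_progLe hm (h.target_mem e) hmv hvm ▸ .acquire e
  | @keep z A v e hA hz ih =>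
    obtain ⟨q, hq, hqz, hold⟩ := ih
    refine ⟨q, hq, hqz.trans (h.progLt_of_edge e).le, fun m hm hqm hmv => ?_⟩
    rcases Node.progLe_or_progLt hmv.self_eq.symm with hvm | hlt
    · exact h.eq_of_progLe_of_progLe hm (h.target_mem e) hmv hvm ▸ .keep e hA hz
    · exact hold m hm hqm (h.progLe_of_edge_of_progLt e hlt)

theorem progLt_of_releases (h : t.IsRawGlobal P) (hr : Releases P t a q r) : q.ProgLt P r :=
  hr.elim fun _ hz => hz.2.progLe.trans_lt (h.progLt_of_edge hz.1)

theorem le_of_releases (h : t.IsRawGlobal P) (hr : Releases P t a q r) : t.Le q r :=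
  h.le_of_progLe (hr.elim fun _ hz => h.mem_nodes_of_mem_acq hz.2.mem_acq)
    (h.mem_nodes_of_mem_rel hr.mem_rel) (h.progLt_of_releases hr).le

theorem progLt_of_releases_of_heldSince (h : t.IsRawGlobal P) (hr : Releases P t a q r)
    (hn : HeldSince P t a q n) : n.ProgLt P r := by
  have hqr := h.progLt_of_releases hr
  rcases Node.progLe_or_progLt (hqr.self_eq.symm.trans hn.progLe.self_eq) with hrn | hnr
  · have hr_rel := hr.mem_rel
    exact absurd (hn.holds r (h.mem_nodes_of_mem_rel hr_rel) hqr.le hrn)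
      (h.not_holds_of_mem_rel hr_rel)
  · exact hnr

theorem releases_unique (h : t.IsRawGlobal P) (hr : Releases P t a q r)
    (hr' : Releases P t a q r') : r = r' := by
  have progLe_of_releases {r r'} (hr : Releases P t a q r) (hr' : Releases P t a q r') :
      r'.ProgLe P r := by
    obtain ⟨z', e', hz'⟩ := hr'
    have hlt := h.progLt_of_releases_of_heldSince hr hz'
    exact ⟨(h.self_eq e').trans hlt.self_eq, (h.idx_succ e').trans_le hlt.idx_lt⟩
  exact h.eq_of_progLe_of_progLe (h.mem_nodes_of_mem_rel hr.mem_rel)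
    (h.mem_nodes_of_mem_rel hr'.mem_rel) (progLe_of_releases hr' hr)
    (progLe_of_releases hr hr')

theorem le_of_reflTransGen_nextAcq (h : t.IsRawGlobal P)
    (hq : Relation.ReflTransGen (NextAcq P t a) q q') : t.Le q q' := by
  refine Relation.reflTransGen_closed ?_ _ _ hq
  rintro q q' ⟨r, hr, hlk⟩
  exact (h.le_of_releases hr).trans (le_of_lk hlk)

theorem le_of_handsOver (h : t.IsRawGlobal P) (hm : m ∈ t.nodes) (hn : n ∈ t.nodes)
    (hmn : HandsOver P t a m n) : t.Le m n := by
  obtain ⟨r, hr, q, hq, hmr, hrq, hqn⟩ := hmn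
  exact (h.le_of_progLe hm (h.mem_nodes_of_mem_rel hr) hmr.le).trans
    (hrq.trans (h.le_of_progLe (h.mem_nodes_of_mem_acq hq) hn hqn))

theorem handsOver_of_reflTransGen_nextAcq (h : t.IsRawGlobal P) (hm : HeldSince P t a q m)
    (hn : HeldSince P t a q' n) (hne : q ≠ q') (hc : Relation.ReflTransGen (NextAcq P t a) q q') :
    HandsOver P t a m n := by
  obtain rfl | ⟨c, ⟨r, hr, hlk⟩, hcq⟩ := hc.cases_head
  · exact absurd rfl hne
  · exact ⟨r, hr.mem_rel, q', hn.mem_acq, h.progLt_of_releases_of_heldSince hr hm,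
      (le_of_lk hlk).trans (h.le_of_reflTransGen_nextAcq hcq), hn.progLe⟩

end IsRawGlobal

namespace IsGlobalTrace
variable {o m n v v' q q' : Node X V N} {a : M}

theorem not_le_of_progLt (h : t.IsGlobalTrace P o) (hv : v ∈ t.nodes) (hv' : v' ∈ t.nodes)
    (hlt : v.ProgLt P v') : ¬ t.Le v' v := fun hle =>
  hlt.idx_lt.ne (congrArg Node.idx (h.le_antisymm _ _ (h.raw.le_of_progLe hv hv' hlt.le) hle))

theorem progLe_of_le (h : t.IsGlobalTrace P o) (hv : v ∈ t.nodes) (hv' : v' ∈ t.nodes)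
    (hs : v.st P.self = v'.st P.self) (hle : t.Le v v') : v.ProgLe P v' :=
  (Node.progLe_or_progLt hs).resolve_right fun hlt => h.not_le_of_progLt hv' hv hlt hle

theorem wellFoundedOn_nodes (h : t.IsGlobalTrace P o) (hfin : t.nodes.Finite) :
    t.nodes.WellFoundedOn fun v v' => t.Le v v' ∧ v ≠ v' := by
  have : IsStrictOrder (Node X V N) fun v v' => t.Le v v' ∧ v ≠ v' :=
    { irrefl := fun _ hv => hv.2 rfl
      trans := fun _ _ _ huv hvw => ⟨huv.1.trans hvw.1,
        fun huw => huv.2 (h.le_antisymm _ _ huv.1 (huw ▸ hvw.1))⟩ }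
  exact hfin.wellFoundedOn

theorem rightUnique_nextAcq (h : t.IsGlobalTrace P o) (a : M) :
    Relator.RightUnique (NextAcq P t a) := by
  rintro q q₁ q₂ ⟨r₁, hr₁, hlk₁⟩ ⟨r₂, hr₂, hlk₂⟩
  obtain rfl := h.raw.releases_unique hr₁ hr₂
  exact h.lk_succ _ _ _ _ hlk₁ hlk₂

theorem exists_releases (h : t.IsGlobalTrace P o) {r} (hr : r ∈ t.rel a) :
    ∃ q, Releases P t a q r :=
  let ⟨z, e⟩ := hr
  (h.raw.exists_heldSince (h.unlock_held _ _ _ e)).imp fun _ hq => ⟨z, e, hq⟩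

theorem exists_reflTransGen_nextAcq (h : t.IsGlobalTrace P o) (hfin : t.nodes.Finite)
    (hq : q ∈ t.acq a) : ∃ b, t.lk a o b ∧ Relation.ReflTransGen (NextAcq P t a) b q := by
  refine (h.wellFoundedOn_nodes hfin).induction (h.raw.mem_nodes_of_mem_acq hq)
    (P := fun q => q ∈ t.acq a →
      ∃ b, t.lk a o b ∧ Relation.ReflTransGen (NextAcq P t a) b q) ?_ hq
  intro q hq_mem ih hq
  obtain ⟨z, hz, -⟩ := h.lk_pred a q hq
  rcases (h.lk_dom _ _ _ hz).1 with hz_rel | rfl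
  · obtain ⟨p, hp⟩ := h.exists_releases hz_rel
    have hp_acq : p ∈ t.acq a := hp.elim fun _ hz => hz.2.mem_acq
    have hp_mem := h.raw.mem_nodes_of_mem_acq hp_acq
    have hpz := h.raw.le_of_releases hp
    have hpq : p ≠ q := by
      rintro rfl
      exact h.not_le_of_progLt hp_mem (h.raw.mem_nodes_of_mem_rel hz_rel)
        (h.raw.progLt_of_releases hp) (le_of_lk hz)
    obtain ⟨b, hb, hbp⟩ := ih p hp_mem ⟨hpz.trans (le_of_lk hz), hpq⟩ hp_acq
    exact ⟨b, hb, hbp.tail ⟨z, hp, hz⟩⟩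
  · exact ⟨q, hz, .refl⟩

theorem mutual_exclusion (h : t.IsGlobalTrace P o) (hfin : t.nodes.Finite) (hm : t.Holds a m)
    (hn : t.Holds a n) (hne : m.st P.self ≠ n.st P.self) :
    HandsOver P t a m n ∨ HandsOver P t a n m := by
  obtain ⟨q, hq⟩ := h.raw.exists_heldSince hm
  obtain ⟨q', hq'⟩ := h.raw.exists_heldSince hn
  have hqq' : q ≠ q' := by
    rintro rfl
    exact hne (hq.progLe.self_eq.symm.trans hq'.progLe.self_eq)
  obtain ⟨b, hb, hbq⟩ := h.exists_reflTransGen_nextAcq hfin hq.mem_acq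
  obtain ⟨b', hb', hbq'⟩ := h.exists_reflTransGen_nextAcq hfin hq'.mem_acq
  obtain rfl := h.lk_succ _ _ _ _ hb hb'
  exact (hbq.total_of_right_unique (h.rightUnique_nextAcq a) hbq').imp
    (h.raw.handsOver_of_reflTransGen_nextAcq hq hq' hqq')
    (h.raw.handsOver_of_reflTransGen_nextAcq hq' hq hqq'.symm)

theorem handsOver_of_le (h : t.IsGlobalTrace P o) (hfin : t.nodes.Finite) (hm : t.Holds a m)
    (hn : t.Holds a n) (hne : m.st P.self ≠ n.st P.self) (hle : t.Le m n) :
    HandsOver P t a m n := by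
  refine (h.mutual_exclusion hfin hm hn hne).resolve_right fun hnm => hne ?_
  rw [h.le_antisymm _ _ hle (h.raw.le_of_handsOver (h.raw.mem_nodes_of_holds hn)
    (h.raw.mem_nodes_of_holds hm) hnm)]

theorem le_total_of_holds (h : t.IsGlobalTrace P o) (hfin : t.nodes.Finite) (hm : t.Holds a m)
    (hn : t.Holds a n) : t.Le m n ∨ t.Le n m := by
  have hm_mem := h.raw.mem_nodes_of_holds hm
  have hn_mem := h.raw.mem_nodes_of_holds hn
  by_cases hs : m.st P.self = n.st P.self
  · exact (Node.progLe_or_progLt hs).imp (h.raw.le_of_progLe hm_mem hn_mem)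
      fun hlt => h.raw.le_of_progLe hn_mem hm_mem hlt.le
  · exact (h.mutual_exclusion hfin hm hn hs).imp (h.raw.le_of_handsOver hm_mem hn_mem)
      (h.raw.le_of_handsOver hn_mem hm_mem)

theorem exists_disjoint_release (h : t.IsGlobalTrace P o) (hfin : t.nodes.Finite)
    (hm : t.Holds a m) (hn : t.Holds a n) (hne : m.st P.self ≠ n.st P.self) (hle : t.Le m n) :
    ∃ b ∈ t.lockset n, ∃ r ∈ t.rel b, m.ProgLt P r ∧ t.Le r n ∧
      Disjoint (t.lockset r) (t.lockset n) := by
  have exists_release {b m} (hm : t.Holds b m) (hn : t.Holds b n)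
      (hne : m.st P.self ≠ n.st P.self) (hle : t.Le m n) :
      ∃ r ∈ t.rel b, m.ProgLt P r ∧ t.Le r n := by
    obtain ⟨r, hr, q, hq, hmr, hrq, hqn⟩ := h.handsOver_of_le hfin hm hn hne hle
    exact ⟨r, hr, hmr, hrq.trans
      (h.raw.le_of_progLe (h.raw.mem_nodes_of_mem_acq hq) (h.raw.mem_nodes_of_holds hn) hqn)⟩
  -- The last release after `m` of a mutex of `n`: a mutex still shared would be released later.
  obtain ⟨r, ⟨b, hb, hr, hmr, hrn⟩, hmax⟩ := Set.exists_max_image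
    {r | ∃ b ∈ t.lockset n, r ∈ t.rel b ∧ m.ProgLt P r ∧ t.Le r n} Node.idx
    (hfin.subset fun r ⟨_, _, hr, _⟩ => h.raw.mem_nodes_of_mem_rel hr)
    ((exists_release hm hn hne hle).imp fun r hr => ⟨a, hn, hr⟩)
  refine ⟨b, hb, r, hr, hmr, hrn, Set.disjoint_left.2 fun c hcr hcn => ?_⟩
  obtain ⟨r', hr', hrr', hrn'⟩ := exists_release hcr hcn (hmr.self_eq ▸ hne) hrn
  exact hrr'.idx_lt.not_ge (hmax r' ⟨c, hcn, hr', hmr.trans hrr', hrn'⟩)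

theorem exists_notMem_lockset_of_mem_rel (h : t.IsGlobalTrace P o) (hfin : t.nodes.Finite) {r}
    (hv : v ∈ t.nodes) (hr : r ∈ t.rel a) (hn : t.Holds a n) (hs : v.st P.self = n.st P.self)
    (hne : r.st P.self ≠ n.st P.self) (hvr : t.Le v r) (hrn : t.Le r n) :
    ∃ p ∈ t.nodes, v.ProgLe P p ∧ p.ProgLe P n ∧ a ∉ t.lockset p := by
  obtain ⟨z, e⟩ := hr
  have hr_mem := h.raw.target_mem e
  have hzr := h.raw.le_of_progLe (h.raw.source_mem e) hr_mem (h.raw.progLt_of_edge e).le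
  obtain ⟨r', hr', q, ⟨p, ep⟩, hlt, hr'q, hqn⟩ :=
    h.handsOver_of_le hfin (h.unlock_held _ _ _ e) hn (h.raw.self_eq e ▸ hne) (hzr.trans hrn)
  have hq_mem := h.raw.target_mem ep
  have hrr' : t.Le r r' := h.raw.le_of_progLe hr_mem (h.raw.mem_nodes_of_mem_rel hr')
    ⟨(h.raw.self_eq e).trans hlt.self_eq, (h.raw.idx_succ e).trans_le hlt.idx_lt⟩
  have hrq := hrr'.trans hr'q
  have hvq : v.ProgLt P q := by
    have hvq := h.progLe_of_le hv hq_mem (hs.trans hqn.self_eq.symm) (hvr.trans hrq)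
    refine ⟨hvq.self_eq, hvq.idx_le.lt_of_ne fun hi => hne ?_⟩
    obtain rfl := h.raw.node_ext hv hq_mem hvq.self_eq hi
    rw [h.le_antisymm _ _ hrq hvr, hs]
  exact ⟨p, h.raw.source_mem ep, h.raw.progLe_of_edge_of_progLt ep hvq,
    (h.raw.progLt_of_edge ep).le.trans hqn, h.lock_free _ _ _ ep⟩

end IsGlobalTrace
end TraceGraph

/-! ### Accesses to globals -/

section Accesses
variable {X G V M N R : Type u} [DecidableEq X] {P : Program X G V M N R}

/-- In every global trace, the global `g` is accessed only at nodes holding the mutex `m_g`. -/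
def Program.ProtectsAccesses (P : Program X G V M N R) : Prop :=
  ∀ (t : TraceGraph X G V M N R) (o : Node X V N), t.IsGlobalTrace P o →
    ∀ v ∈ t.nodes, ∀ A u' g, (v.pt, A, u') ∈ P.edges → A.Accesses g → t.Holds (P.mtx g) v

theorem Program.WellFormed.protectsAccesses (hP : P.WellFormed) : P.ProtectsAccesses := by
  intro t o h v hv A u' g hA hg
  by_cases hs : v ∈ t.starts
  · obtain ⟨hu₀, hcreate⟩ := hP.access_not_start g _ _ _ hA hg
    rcases eq_or_ne v o with rfl | ho
    · exact absurd h.root_pt hu₀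
    · obtain ⟨z, hz, -⟩ := h.cr_pred v hs ho
      obtain ⟨-, -, -, x, u₁, hc⟩ := h.cr_dom _ _ hz
      exact absurd hc (hcreate _ _ _)
  · obtain ⟨z, B, e⟩ : ∃ z B, (z, B, v) ∈ t.edges := by
      by_contra! hne
      exact hs ⟨hv, hne⟩
    obtain rfl := hP.access_locked g _ _ _ hA hg _ _ (h.raw.cfg_edge e)
    exact .acquire e

theorem Program.ProtectsAccesses.holds_of_write (hP : P.ProtectsAccesses)
    {t : TraceGraph X G V M N R} {o} (h : t.IsGlobalTrace P o) {z g x z'}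
    (e : (z, Act.write g x, z') ∈ t.edges) : t.Holds (P.mtx g) z' :=
  .keep e nofun
    (hP t o h z (h.raw.source_mem e) _ _ g (h.raw.cfg_edge e) (Or.inr ⟨x, rfl⟩))

end Accesses

namespace TraceGraph
variable {X G V M N R : Type u}

/-- The edge `(z, g = y, z')` is a maximal one among the writes to `g` causally before `v`. -/
structure IsMaxWriteBefore (t : TraceGraph X G V M N R) (g : G) (v z : Node X V N) (y : X)
    (z' : Node X V N) : Prop where
  edge : (z, Act.write g y, z') ∈ t.edges
  le : t.Le z' v
  eq_of_le : ∀ z₂ y₂ z₂', (z₂, Act.write g y₂, z₂') ∈ t.edges → t.Le z₂' v → t.Le z' z₂' → z₂' = z'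

namespace IsMaxWriteBefore
variable [DecidableEq X] {P : Program X G V M N R} {t : TraceGraph X G V M N R}
  {o v z z' w w' : Node X V N} {g : G} {x y : X}

theorem le_of_write (hw : t.IsMaxWriteBefore g v z y z') (hP : P.ProtectsAccesses)
    (h : t.IsGlobalTrace P o) (hfin : t.nodes.Finite) (e : (w, Act.write g x, w') ∈ t.edges)
    (hle : t.Le w' v) : t.Le w' z' := by
  rcases h.le_total_of_holds hfin (hP.holds_of_write h e) (hP.holds_of_write h hw.edge) with h' | h'
  · exact h'
  · exact hw.eq_of_le _ _ _ e hle h' ▸ .refl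

theorem exists_disjoint_release (hw : t.IsMaxWriteBefore g v z y z') (hP : P.ProtectsAccesses)
    (h : t.IsGlobalTrace P o) (hfin : t.nodes.Finite) (hv : t.Holds (P.mtx g) v)
    (hne : z'.st P.self ≠ v.st P.self) :
    ∃ a ∈ t.lockset v, ∃ r ∈ t.rel a, z'.ProgLt P r ∧ t.Le r v ∧
      Disjoint (t.lockset r) (t.lockset v) :=
  h.exists_disjoint_release hfin (hP.holds_of_write h hw.edge) hv hne hw.le

theorem exists_disjoint_lockset (hw : t.IsMaxWriteBefore g v z y z') (hP : P.ProtectsAccesses)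
    (h : t.IsGlobalTrace P o) (hfin : t.nodes.Finite) (hv : v ∈ t.nodes)
    (hne : z'.st P.self ≠ v.st P.self) (e : (w, Act.write g x, w') ∈ t.edges)
    (hwv : w'.ProgLe P v) :
    ∃ n ∈ t.nodes, w'.ProgLe P n ∧ n.ProgLe P v ∧ Disjoint (t.lockset n) (t.lockset z') := by
  have hle := hw.le_of_write hP h hfin e (h.raw.le_of_progLe (h.raw.target_mem e) hv hwv)
  obtain ⟨b, -, r, hr, hwr, hrz, hdisj⟩ := h.exists_disjoint_release hfin (hP.holds_of_write h e)
    (hP.holds_of_write h hw.edge) (hwv.self_eq.trans_ne hne.symm) hle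
  have hr_mem := h.raw.mem_nodes_of_mem_rel hr
  exact ⟨r, hr_mem, hwr.le, h.progLe_of_le hr_mem hv (hwr.self_eq.symm.trans hwv.self_eq)
    (hrz.trans hw.le), hdisj⟩

theorem exists_notMem_lockset (hw : t.IsMaxWriteBefore g v z y z') (hP : P.ProtectsAccesses)
    (h : t.IsGlobalTrace P o) (hfin : t.nodes.Finite) (hv : v ∈ t.nodes)
    (hne : z'.st P.self ≠ v.st P.self) {a r} (ha : a ∈ t.lockset v) (hr : r ∈ t.rel a)
    (hzr : z'.ProgLt P r) (hrv : t.Le r v) (e : (w, Act.write g x, w') ∈ t.edges)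
    (hwv : w'.ProgLe P v) :
    ∃ n ∈ t.nodes, w'.ProgLe P n ∧ n.ProgLe P v ∧ a ∉ t.lockset n := by
  have hw_mem := h.raw.target_mem e
  have hwz := hw.le_of_write hP h hfin e (h.raw.le_of_progLe hw_mem hv hwv)
  have hzr' := h.raw.le_of_progLe (h.raw.target_mem hw.edge) (h.raw.mem_nodes_of_mem_rel hr) hzr.le
  exact h.exists_notMem_lockset_of_mem_rel hfin hw_mem hr ha hwv.self_eq
    (hzr.self_eq.symm.trans_ne hne) (hwz.trans hzr') hrv

end IsMaxWriteBefore

/-! ### Subtraces -/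

/-- `t'` is a subgraph of `t`, where the sinks are ignored. -/
structure IsSub (t' t : TraceGraph X G V M N R) : Prop where
  nodes : t'.nodes ⊆ t.nodes
  edges : t'.edges ⊆ t.edges

namespace IsSub
variable {t t' t'' : TraceGraph X G V M N R}

theorem trans (h : t''.IsSub t') (h' : t'.IsSub t) : t''.IsSub t :=
  ⟨h.nodes.trans h'.nodes, h.edges.trans h'.edges⟩

variable [DecidableEq X] {P : Program X G V M N R} {v n z : Node X V N} {A : Act X G M N R} {a : M}

theorem mem_edges (hs : t'.IsSub t) (h' : t'.IsRawGlobal P) (h : t.IsRawGlobal P)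
    (e : (z, A, v) ∈ t.edges) (hv : v ∈ t'.nodes) : (z, A, v) ∈ t'.edges := by
  obtain ⟨z', A', e'⟩ := h'.exists_pred hv (by have := h.idx_succ e; omega)
  obtain ⟨rfl, rfl⟩ := h.pred_unique e (hs.edges e')
  exact e'

theorem mem_nodes (hs : t'.IsSub t) (h' : t'.IsRawGlobal P) (h : t.IsRawGlobal P)
    (hn : n ∈ t.nodes) (hv : v ∈ t'.nodes) (hnv : n.ProgLe P v) : n ∈ t'.nodes := by
  obtain ⟨z, hz, hzs, hzi⟩ := h'.exists_node hv hnv.idx_le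
  rwa [h.node_ext hn (hs.nodes hz) (hnv.self_eq.trans hzs.symm) hzi.symm]

theorem holds_iff (hs : t'.IsSub t) (h' : t'.IsRawGlobal P) (h : t.IsRawGlobal P)
    (hv : v ∈ t'.nodes) : t.Holds a v ↔ t'.Holds a v := by
  constructor
  · intro ha
    induction ha with
    | acquire e => exact .acquire (hs.mem_edges h' h e hv)
    | keep e hA _ ih =>
      have e' := hs.mem_edges h' h e hv
      exact .keep e' hA (ih (h'.source_mem e'))
  · intro ha
    induction ha with
    | acquire e => exact .acquire (hs.edges e)
    | keep e hA _ ih => exact .keep (hs.edges e) hA (ih (h'.source_mem e))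

theorem lockset_eq (hs : t'.IsSub t) (h' : t'.IsRawGlobal P) (h : t.IsRawGlobal P)
    (hv : v ∈ t'.nodes) : t.lockset v = t'.lockset v :=
  Set.ext fun _ => hs.holds_iff h' h hv

end IsSub
end TraceGraph

/-! ### Prolongations of the ego thread -/

namespace LocalTrace
variable {X G V M N R : Type u} [DecidableEq X] {P : Program X G V M N R}
  {ν : LocalTrace P → P.tids} {t t₀ t' : LocalTrace P} {A : Act X G M N R} {g : G} {a : M}
  {n v v' z : Node X V N} {x y : X}

theorem raw (t : LocalTrace P) : t.1.IsRawGlobal P := t.2.1.elim fun _ h => h.raw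

theorem sink_mem (t : LocalTrace P) : t.1.sink ∈ t.1.nodes := t.2.2.1

theorem progLe_sink (t : LocalTrace P) (hn : n ∈ t.1.nodes) (hs : n.st P.self = t.id) :
    n.ProgLe P t.1.sink :=
  t.2.1.elim fun _ h => h.progLe_of_le hn t.sink_mem hs (t.2.2.2 n hn)

theorem LastTlWrite.target_mem (h : t.LastTlWrite g v x v') : v' ∈ t.1.nodes :=
  t.raw.target_mem h.1

theorem LastTlWrite.progLe_sink (h : t.LastTlWrite g v x v') : v'.ProgLe P t.1.sink :=
  t.progLe_sink h.target_mem ((t.raw.self_eq h.1).trans h.2.1)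

theorem noTlWrite_or_exists_lastTlWrite (hfin : t.1.nodes.Finite) (g : G) :
    t.NoTlWrite g ∨ ∃ v x v', t.LastTlWrite g v x v' := by
  refine or_iff_not_imp_left.2 fun hno => ?_
  simp only [NoTlWrite, not_forall, not_not] at hno
  obtain ⟨z, y, z', e, hz⟩ := hno
  obtain ⟨v', ⟨v, x, e', hv⟩, hmax⟩ := Set.exists_max_image
    {n | ∃ z y, (z, Act.write g y, n) ∈ t.1.edges ∧ z.st P.self = t.id} Node.idx
    (hfin.subset fun n ⟨_, _, e, _⟩ => t.raw.target_mem e) ⟨z', z, y, e, hz⟩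
  exact ⟨v, x, v', e', hv, fun z y z' e hz => hmax z' ⟨z, y, e, hz⟩⟩

theorem lastTlWrite_of_isMaxWriteBefore {z'} (hw : t.1.IsMaxWriteBefore g v z y z')
    (hsub : t'.1.IsSub t.1) (hz : z'.ProgLe P t'.1.sink) (hv : t.1.Le t'.1.sink v) :
    t'.LastTlWrite g z y z' := by
  have hz' := hsub.mem_nodes t'.raw t.raw (t.raw.target_mem hw.edge) t'.sink_mem hz
  refine ⟨hsub.mem_edges t'.raw t.raw hw.edge hz',
    (t.raw.self_eq hw.edge).symm.trans hz.self_eq, fun w x w' e hs => ?_⟩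
  have hw_sink := t'.progLe_sink (t'.raw.target_mem e) ((t'.raw.self_eq e).trans hs)
  have hw_mem := hsub.nodes (t'.raw.target_mem e)
  have hwv := (t.raw.le_of_progLe hw_mem (hsub.nodes t'.sink_mem) hw_sink).trans hv
  rcases Node.progLe_or_progLt (hw_sink.self_eq.trans hz.self_eq.symm) with hle | hlt
  · exact hle.idx_le
  · have hzw := t.raw.le_of_progLe (hsub.nodes hz') hw_mem hlt.le
    exact (congrArg Node.idx (hw.eq_of_le _ _ _ (hsub.edges e) hwv hzw)).le

/-- The local trace `t` contains `t₀` and prolongs its ego thread by the action `A`. It may contain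
further threads, as it does when `A` is a `lock` operation. -/
structure Prolongs (ν : LocalTrace P → P.tids) (t₀ : LocalTrace P) (A : Act X G M N R)
    (t : LocalTrace P) : Prop where
  sub : t₀.1.IsSub t.1
  edge : (t₀.1.sink, A, t.1.sink) ∈ t.1.edges
  create_id : ∀ x u₁, A = .create x u₁ → t.1.sink.st x = ν t₀

theorem prolongs_of_mem_sem {u u'} (h : t ∈ sem ν u A u' t₀) : Prolongs ν t₀ A t := by
  obtain ⟨-, σ', ht, hν⟩ := h
  refine ⟨⟨?_, ?_⟩, ?_, ?_⟩ <;> rw [ht]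
  · exact Set.subset_insert _ _
  · exact Set.subset_insert _ _
  · exact Set.mem_insert _ _
  · exact hν

theorem prolongs_of_mem_semLock {u u'} (h : t ∈ semLock u a u' t₀ t') :
    Prolongs ν t₀ (.lock a) t := by
  obtain ⟨-, -, ht⟩ := h
  refine ⟨⟨?_, ?_⟩, ?_, nofun⟩ <;> rw [ht]
  · exact Set.subset_union_left.trans (Set.subset_insert _ _)
  · exact Set.subset_union_left.trans (Set.subset_insert _ _)
  · exact Set.mem_insert _ _

theorem isSub_of_mem_semLock {u u'} (h : t ∈ semLock u a u' t₀ t') : t'.1.IsSub t.1 := by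
  rw [h.2.2]
  exact ⟨Set.subset_union_right.trans (Set.subset_insert _ _),
    Set.subset_union_right.trans (Set.subset_insert _ _)⟩

namespace Prolongs

theorem id_eq (h : Prolongs ν t₀ A t) : t.id = t₀.id := t.raw.self_eq h.edge

theorem cfg_edge (h : Prolongs ν t₀ A t) : (t₀.loc, A, t.loc) ∈ P.edges := t.raw.cfg_edge h.edge

theorem step (h : Prolongs ν t₀ A t) : P.Step A t₀.1.sink.st t.1.sink.st := t.raw.step h.edge

theorem mem_nodes (h : Prolongs ν t₀ A t) (hn : n ∈ t.1.nodes) (hle : n.ProgLe P t₀.1.sink) :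
    n ∈ t₀.1.nodes :=
  h.sub.mem_nodes t₀.raw t.raw hn t₀.sink_mem hle

theorem eq_sink_or_mem_nodes (h : Prolongs ν t₀ A t) (hn : n ∈ t.1.nodes)
    (hs : n.st P.self = t.id) : n = t.1.sink ∨ n ∈ t₀.1.nodes := by
  rcases Node.progLe_or_progLt hs.symm with hle | hlt
  · exact Or.inl (t.raw.eq_of_progLe_of_progLe hn t.sink_mem (t.progLe_sink hn hs) hle)
  · exact Or.inr (h.mem_nodes hn (t.raw.progLe_of_edge_of_progLt h.edge hlt))

theorem lockset_eq (h : Prolongs ν t₀ A t) (hv : v ∈ t₀.1.nodes) :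
    t.1.lockset v = t₀.1.lockset v :=
  h.sub.lockset_eq t₀.raw t.raw hv

theorem locks_eq (h : Prolongs ν t₀ A t) : t.locks = A.lockset t₀.locks :=
  (t.raw.lockset_edge h.edge).trans (congrArg A.lockset (h.lockset_eq t₀.sink_mem))

theorem mem_edges_write_iff (h : Prolongs ν t₀ A t) (hA : ∀ y, A ≠ .write g y)
    (hs : z.st P.self = t.id) :
    (z, Act.write g y, v) ∈ t.1.edges ↔ (z, Act.write g y, v) ∈ t₀.1.edges := by
  refine ⟨fun e => ?_, fun e => h.sub.edges e⟩
  rcases h.eq_sink_or_mem_nodes (t.raw.target_mem e) ((t.raw.self_eq e).trans hs) with rfl | hv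
  · exact absurd (t.raw.pred_unique h.edge e).2 (hA y)
  · exact h.sub.mem_edges t₀.raw t.raw e hv

theorem lastTlWrite_iff (h : Prolongs ν t₀ A t) (hA : ∀ y, A ≠ .write g y) :
    t.LastTlWrite g v x v' ↔ t₀.LastTlWrite g v x v' := by
  unfold LastTlWrite
  rw [← h.id_eq]
  constructor
  · rintro ⟨e, hv, hmax⟩
    exact ⟨(h.mem_edges_write_iff hA hv).1 e, hv,
      fun z y z' e' hz => hmax z y z' (h.sub.edges e') hz⟩
  · rintro ⟨e, hv, hmax⟩
    exact ⟨h.sub.edges e, hv,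
      fun z y z' e' hz => hmax z y z' ((h.mem_edges_write_iff hA hz).1 e') hz⟩

theorem noTlWrite (h : Prolongs ν t₀ A t) (hno : t.NoTlWrite g) : t₀.NoTlWrite g :=
  fun z y z' e => h.id_eq ▸ hno z y z' (h.sub.edges e)

theorem not_noTlWrite (h : Prolongs ν t₀ (.write g x) t) : ¬ t.NoTlWrite g :=
  fun hno => hno _ _ _ h.edge h.id_eq.symm

theorem eq_of_lastTlWrite (h : Prolongs ν t₀ (.write g x) t) (hl : t.LastTlWrite g v y v') :
    v = t₀.1.sink ∧ y = x ∧ v' = t.1.sink := by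
  have hsink : t.1.sink.ProgLe P v' :=
    ⟨hl.progLe_sink.self_eq.symm, hl.2.2 _ _ _ h.edge h.id_eq.symm⟩
  obtain rfl := t.raw.eq_of_progLe_of_progLe hl.target_mem t.sink_mem hl.progLe_sink hsink
  obtain ⟨rfl, hA⟩ := t.raw.pred_unique hl.1 h.edge
  simp only [Act.write.injEq, true_and] at hA
  exact ⟨rfl, hA, rfl⟩

end Prolongs
end LocalTrace

/-! ### The abstraction of local traces -/

theorem Act.subset_lockset {X G M N R : Type u} {A : Act X G M N R} (hA : ∀ a, A ≠ .unlock a)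
    (S : Set M) : S ⊆ A.lockset S := by
  cases A with
  | lock a => exact Set.subset_union_left
  | unlock a => exact absurd rfl (hA a)
  | _ => exact subset_rfl

namespace LocalTrace

section Abstraction
variable {X G V M N R : Type u} [DecidableEq X] {P : Program X G V M N R}
  {ν : LocalTrace P → P.tids} {t t₀ : LocalTrace P} {A : Act X G M N R} {g : G}
  {v v' : Node X V N} {x : X} {U : UpLocks M}

theorem betaW_le :
    t.betaW g ≤ U ↔ ∀ v x v', t.LastTlWrite g v x v' → t.1.lockset v' ∈ U.sets := by
  rw [betaW, UpLocks.closure_le]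
  constructor
  · exact fun h v x v' hl => h ⟨v, x, v', hl, rfl⟩
  · rintro h _ ⟨v, x, v', hl, rfl⟩
    exact h v x v' hl

theorem betaP_le :
    t.betaP g ≤ U ↔ (t.NoTlWrite g → ∅ ∈ U.sets) ∧ ∀ v x v', t.LastTlWrite g v x v' →
      ∀ n ∈ t.1.nodes, v'.ProgLe P n → t.1.lockset n ∈ U.sets := by
  rw [betaP, UpLocks.closure_le]
  constructor
  · refine fun h => ⟨fun hno => h (Or.inl ⟨hno, rfl⟩), fun v x v' hl n hn hvn => ?_⟩
    exact h (Or.inr ⟨v, x, v', hl, subset_upperClosure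
      ⟨n, hn, hvn.self_eq.symm.trans hl.progLe_sink.self_eq, hvn.idx_le, rfl⟩⟩)
  · rintro ⟨hno, hl⟩ L (⟨hno', rfl⟩ | ⟨v, x, v', hl', _, ⟨n, hn, hs, hi, rfl⟩, hL⟩)
    · exact hno hno'
    · exact UpLocks.mem_sets_of_subset hL
        (hl v x v' hl' n hn ⟨hl'.progLe_sink.self_eq.trans hs.symm, hi⟩)

theorem exists_mins_of_betaP_le {p : Set M → Prop} (hp : Antitone p) (hp0 : p ∅)
    (hfin : t.1.nodes.Finite) (hU : t.betaP g ≤ U)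
    (h : ∀ v x v', t.LastTlWrite g v x v' →
      ∃ n ∈ t.1.nodes, v'.ProgLe P n ∧ p (t.1.lockset n)) : ∃ T ∈ U.mins, p T := by
  obtain ⟨hno, hl⟩ := betaP_le.1 hU
  obtain ⟨S, hS_fin, hS, hpS⟩ : ∃ S : Set M, S.Finite ∧ S ∈ U.sets ∧ p S := by
    rcases noTlWrite_or_exists_lastTlWrite hfin g with hno' | ⟨v, x, v', hl'⟩
    · exact ⟨∅, Set.finite_empty, hno hno', hp0⟩
    · obtain ⟨n, hn, hvn, hpn⟩ := h v x v' hl'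
      exact ⟨_, t.raw.finite_lockset hn, hl v x v' hl' n hn hvn, hpn⟩
  exact (UpLocks.exists_mins_subset hS_fin hS).imp fun T hT => ⟨hT.1, hp hT.2 hpS⟩

theorem not_lastTlWrite_of_idx_zero (h0 : t.1.sink.idx = 0) : ¬ t.LastTlWrite g v x v' := fun hl =>
  absurd (t.raw.idx_succ hl.1) (by have := hl.progLe_sink.idx_le; omega)

theorem LastTlWrite.notMem_init (hl : t.LastTlWrite g v x v') : t ∉ init P := by
  rintro ⟨σ, -, ht⟩
  exact not_lastTlWrite_of_idx_zero (by rw [ht]; rfl) hl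

namespace Prolongs

theorem betaW_le_betaW (h : Prolongs ν t₀ A t) (hA : ∀ y, A ≠ .write g y) :
    t.betaW g ≤ t₀.betaW g := by
  refine betaW_le.2 fun v x v' hl => ?_
  rw [h.lastTlWrite_iff hA] at hl
  exact h.lockset_eq hl.target_mem ▸ betaW_le.1 le_rfl v x v' hl

theorem betaP_le_of_ne_write (h : Prolongs ν t₀ A t) (hA : ∀ y, A ≠ .write g y)
    (hU : t₀.betaP g ≤ U) (hS : t₀.locks ∈ U.sets → t.locks ∈ U.sets) : t.betaP g ≤ U := by
  obtain ⟨hno, hlast⟩ := betaP_le.1 hU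
  refine betaP_le.2 ⟨fun hno' => hno (h.noTlWrite hno'), fun v x v' hl n hn hvn => ?_⟩
  have hs := hvn.self_eq.symm.trans hl.progLe_sink.self_eq
  rw [h.lastTlWrite_iff hA] at hl
  rcases h.eq_sink_or_mem_nodes hn hs with rfl | hn'
  · exact hS (hlast v x v' hl _ t₀.sink_mem hl.progLe_sink)
  · exact h.lockset_eq hn' ▸ hlast v x v' hl n hn' hvn

theorem betaVal_inr (h : Prolongs ν t₀ A t) (hA : ∀ y, A ≠ .write g y) :
    t.betaVal (.inr g) = t₀.betaVal (.inr g) := by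
  simp only [betaVal, h.lastTlWrite_iff hA]

theorem betaW_le_single (h : Prolongs ν t₀ (.write g x) t) : t.betaW g ≤ .single t.locks := by
  refine betaW_le.2 fun v y v' hl => ?_
  obtain ⟨-, -, rfl⟩ := h.eq_of_lastTlWrite hl
  exact UpLocks.mem_single_self

theorem betaP_le_single (h : Prolongs ν t₀ (.write g x) t) : t.betaP g ≤ .single t.locks := by
  refine betaP_le.2 ⟨fun hno => absurd hno h.not_noTlWrite, fun v y v' hl n hn hvn => ?_⟩
  obtain ⟨-, -, rfl⟩ := h.eq_of_lastTlWrite hl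
  obtain rfl := t.raw.eq_of_progLe_of_progLe hn t.sink_mem
    (t.progLe_sink hn hvn.self_eq.symm) hvn
  exact UpLocks.mem_single_self

theorem betaVal_inr_subset (h : Prolongs ν t₀ (.write g x) t) :
    t.betaVal (.inr g) ⊆ t₀.betaVal (.inl x) := by
  rintro _ ⟨v, y, v', hl, rfl⟩
  obtain ⟨rfl, rfl, -⟩ := h.eq_of_lastTlWrite hl
  rfl

end Prolongs
end Abstraction

/-! ### Reachable local traces -/

section Reachable
variable {X G V M N R : Type u} [DecidableEq X] {P : Program X G V M N R}
  {ν : LocalTrace P → P.tids} {t t₀ t₁ : LocalTrace P} {Q : LocalTrace P → Prop} {n : Node X V N}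

theorem Reachable.finite (h : Reachable ν t) : t.1.nodes.Finite := by
  induction h with
  | init ht =>
    obtain ⟨σ, -, ht⟩ := ht
    exact ht ▸ Set.finite_singleton _
  | new _ ht ih => exact ht.2 ▸ ih.insert _
  | step _ _ _ ht ih =>
    obtain ⟨-, σ', ht, -⟩ := ht
    exact ht ▸ ih.insert _
  | lock _ _ _ ht ih₀ ih₁ => exact ht.2.2 ▸ (ih₀.union ih₁).insert _

/-- Every node of `t` other than the sink is the sink of a subtrace of `t` that satisfies `Q`. -/
def PrefixesSatisfy (Q : LocalTrace P → Prop) (t : LocalTrace P) : Prop :=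
  ∀ n ∈ t.1.nodes, n ≠ t.1.sink → ∃ t' : LocalTrace P, t'.1.IsSub t.1 ∧ t'.1.sink = n ∧ Q t'

theorem PrefixesSatisfy.exists_isSub (h : PrefixesSatisfy Q t) (ht : Q t) (hsub : t.1.IsSub t₁.1)
    (hn : n ∈ t.1.nodes) : ∃ t' : LocalTrace P, t'.1.IsSub t₁.1 ∧ t'.1.sink = n ∧ Q t' := by
  rcases eq_or_ne n t.1.sink with rfl | hne
  · exact ⟨t, hsub, rfl, ht⟩
  · obtain ⟨t', hsub', hsink, ht'⟩ := h n hn hne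
    exact ⟨t', hsub'.trans hsub, hsink, ht'⟩

theorem Reachable.induction_prefixes (h : Reachable ν t)
    (init : ∀ t ∈ LocalTrace.init P, Q t)
    (new : ∀ t₀ u₁ t, Reachable ν t → t ∈ LocalTrace.new ν u₁ t₀ → Q t₀ → Q t)
    (prolong : ∀ t₀ A t, Reachable ν t → Prolongs ν t₀ A t → PrefixesSatisfy Q t → Q t₀ → Q t) :
    Q t := by
  suffices Q t ∧ PrefixesSatisfy Q t from this.1
  induction h with
  | @init t ht =>
    refine ⟨init t ht, fun n hn hne => absurd ?_ hne⟩
    obtain ⟨σ, -, ht⟩ := ht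
    rw [ht] at hn ⊢
    exact hn
  | @new u₁ t₀ t hr ht ih =>
    refine ⟨new t₀ u₁ t (.new hr ht) ht ih.1, fun n hn hne => ?_⟩
    have hsub : t₀.1.IsSub t.1 := ht.2 ▸ ⟨Set.subset_insert _ _, subset_rfl⟩
    rw [ht.2] at hn hne
    exact ih.2.exists_isSub ih.1 hsub (hn.resolve_left hne)
  | @step u A u' t₀ t he hA hr ht ih =>
    have hp := prolongs_of_mem_sem ht
    have hpre : PrefixesSatisfy Q t := fun n hn hne => by
      obtain ⟨-, σ', ht, -⟩ := ht
      rw [ht] at hn hne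
      exact ih.2.exists_isSub ih.1 hp.sub (hn.resolve_left hne)
    exact ⟨prolong t₀ A t (.step he hA hr ht) hp hpre ih.1, hpre⟩
  | @lock u a u' t₀ t₁ t he hr₀ hr₁ ht ih₀ ih₁ =>
    have hp : Prolongs ν t₀ (.lock a) t := prolongs_of_mem_semLock ht
    have hpre : PrefixesSatisfy Q t := fun n hn hne => by
      have hsub₁ := isSub_of_mem_semLock ht
      rw [ht.2.2] at hn hne
      exact (hn.resolve_left hne).elim (ih₀.2.exists_isSub ih₀.1 hp.sub)
        (ih₁.2.exists_isSub ih₁.1 hsub₁)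
    exact ⟨prolong t₀ _ t (.lock he hr₀ hr₁ ht) hp hpre ih₀.1, hpre⟩

theorem loc_of_mem_init (ht : t ∈ init P) : t.loc = P.u₀ := by
  obtain ⟨σ, -, ht⟩ := ht
  rw [loc, ht]
  rfl

theorem loc_of_mem_new {u₁} (ht : t ∈ new ν u₁ t₀) : t.loc = u₁ := by
  rw [loc, ht.2]
  rfl

theorem loc_of_mem_sem {u A u'} (ht : t ∈ sem ν u A u' t₀) : t.loc = u' := by
  obtain ⟨-, σ', ht, -⟩ := ht
  rw [loc, ht]
  rfl

theorem loc_of_mem_semLock {u a u'} (ht : t ∈ semLock u a u' t₀ t₁) : t.loc = u' := by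
  rw [loc, ht.2.2]
  rfl

/-- The sets of reachable local traces that may be values of the unknowns of the local constraint
system: those ending at the point `u`, and those that may hand over the mutex `a`. -/
def reachableTraces (ν : LocalTrace P → P.tids) : ConcUnk M N → Set (LocalTrace P)
  | .pt u => {t | Reachable ν t ∧ t.loc = u}
  | .mx a => {t | Reachable ν t ∧ (t ∈ init P ∨ t.LastIs (.unlock a))}

theorem isSolution_reachableTraces (ν : LocalTrace P → P.tids) :
    IsSolution (concSystem ν) (reachableTraces ν) := by
  rintro c ((rfl | ⟨a, rfl⟩) | ⟨u, A, u', he, rfl⟩)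
  · exact ⟨fun _ => Set.empty_subset _, fun t ht => ⟨.init ht, loc_of_mem_init ht⟩⟩
  · exact ⟨fun _ => Set.empty_subset _, fun t ht => ⟨.init ht, Or.inl ht⟩⟩
  · have mem_pt (hA : ∀ a, A ≠ .lock a) : ∀ t, (∃ t₀ ∈ reachableTraces ν (.pt u),
        t ∈ sem ν u A u' t₀) → t ∈ reachableTraces ν (.pt u') :=
      fun t ⟨t₀, ht₀, ht⟩ => ⟨.step he hA ht₀.1 ht, loc_of_mem_sem ht⟩
    cases A with
    | create x u₁ =>
      refine ⟨?_, mem_pt nofun⟩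
      rintro (v | b)
      · rintro t ⟨rfl, t₀, ht₀, ht⟩
        exact ⟨.new ht₀.1 ht, loc_of_mem_new ht⟩
      · exact Set.empty_subset _
    | lock a =>
      refine ⟨fun _ => Set.empty_subset _, ?_⟩
      rintro t ⟨t₀, ht₀, t₁, ht₁, ht⟩
      exact ⟨.lock he ht₀.1 ht₁.1 ht, loc_of_mem_semLock ht⟩
    | unlock a =>
      refine ⟨?_, mem_pt nofun⟩
      rintro (v | b)
      · exact Set.empty_subset _
      · rintro t ⟨rfl, t₀, ht₀, ht⟩
        exact ⟨.step he nofun ht₀.1 ht, Or.inr ⟨_, (prolongs_of_mem_sem ht).edge⟩⟩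
    | _ => exact ⟨fun _ => Set.empty_subset _, mem_pt nofun⟩

end Reachable
end LocalTrace

/-! ### Abstract transfer along prolongations -/

section Transfer
open LocalTrace

section GammaPt
variable {X G V M N R D : Type u} [DecidableEq X] {P : Program X G V M N R}
  {ν : LocalTrace P → P.tids} {γ : D → Set V} {t t₀ : LocalTrace P} {A : Act X G M N R} {u : N}
  {S : Set M} {s : AbsState X G M D} {σ' : X ⊕ G → D} {x : X} {g : G}

theorem gammaPt_mono [Preorder D] (hγ : Monotone γ) (u : N) (S : Set M) :
    Monotone (gammaPt ν γ u S : AbsState X G M D → Set (LocalTrace P)) :=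
  fun _ _ ⟨hW, hQ, hσ⟩ _ ⟨hS, hu, hW', hQ', hσ'⟩ =>
    ⟨hS, hu, fun g => (hW' g).trans (hW g), fun g => (hQ' g).trans (hQ g),
      fun y => (hσ' y).trans (hγ (hσ y))⟩

theorem mem_gammaPt_of_idx_zero (hr : Reachable ν t) (h0 : t.1.sink.idx = 0) {W : G → UpLocks M}
    (hσ : ∀ x, t.1.sink.st x ∈ γ (σ' (.inl x))) :
    t ∈ gammaPt ν γ t.loc ∅ (W, fun _ => .single ∅, σ') := by
  refine ⟨⟨hr, t.raw.lockset_of_idx_zero h0⟩, rfl, fun g => ?_, fun g => ?_, ?_⟩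
  · exact betaW_le.2 fun v x v' hl => absurd hl (not_lastTlWrite_of_idx_zero h0)
  · exact betaP_le.2 ⟨fun _ => UpLocks.mem_single_self,
      fun v x v' hl => absurd hl (not_lastTlWrite_of_idx_zero h0)⟩
  · rintro (x | g)
    · exact Set.singleton_subset_iff.2 (hσ x)
    · rintro _ ⟨v, x, v', hl, -⟩
      exact absurd hl (not_lastTlWrite_of_idx_zero h0)

namespace LocalTrace.Prolongs

theorem mem_gammaPt_of_ne_write (h : Prolongs ν t₀ A t) (hr : Reachable ν t)
    (ht₀ : t₀ ∈ gammaPt ν γ u S s) (hA : ∀ g y, A ≠ .write g y) {Q : G → UpLocks M}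
    (hQ : s.2.1 ≤ Q) (hlocks : ∀ g, t₀.locks ∈ (Q g).sets → t.locks ∈ (Q g).sets)
    (hX : ∀ x, t.1.sink.st x ∈ γ (σ' (.inl x)))
    (hG : ∀ g, t₀.betaVal (.inr g) ⊆ γ (σ' (.inr g))) :
    t ∈ gammaPt ν γ t.loc t.locks (s.1, Q, σ') := by
  obtain ⟨-, -, hW, hQ₀, -⟩ := ht₀
  refine ⟨⟨hr, rfl⟩, rfl, fun g => (h.betaW_le_betaW (hA g)).trans (hW g),
    fun g => h.betaP_le_of_ne_write (hA g) ((hQ₀ g).trans (hQ g)) (hlocks g), ?_⟩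
  rintro (x | g)
  · exact Set.singleton_subset_iff.2 (hX x)
  · exact h.betaVal_inr (hA g) ▸ hG g

theorem mem_gammaPt_of_ne_write_of_ne_unlock (h : Prolongs ν t₀ A t) (hr : Reachable ν t)
    (ht₀ : t₀ ∈ gammaPt ν γ u S s) (hwrite : ∀ g y, A ≠ .write g y) (hunlock : ∀ a, A ≠ .unlock a)
    (hX : ∀ x, t.1.sink.st x ∈ γ (σ' (.inl x)))
    (hG : ∀ g, t₀.betaVal (.inr g) ⊆ γ (σ' (.inr g))) :
    t ∈ gammaPt ν γ t.loc t.locks (s.1, s.2.1, σ') :=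
  h.mem_gammaPt_of_ne_write hr ht₀ hwrite le_rfl
    (fun _ => UpLocks.mem_sets_of_subset (h.locks_eq ▸ A.subset_lockset hunlock _)) hX hG

theorem mem_gammaPt_update_inl [DecidableEq G] (h : Prolongs ν t₀ A t) (hr : Reachable ν t)
    (ht₀ : t₀ ∈ gammaPt ν γ u S s) (hwrite : ∀ g y, A ≠ .write g y) (hunlock : ∀ a, A ≠ .unlock a)
    (hst : ∃ e, t.1.sink.st = Function.update t₀.1.sink.st x e) {d : D}
    (hd : t.1.sink.st x ∈ γ d) :
    t ∈ gammaPt ν γ t.loc t.locks (s.1, s.2.1, Function.update s.2.2 (.inl x) d) := by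
  refine h.mem_gammaPt_of_ne_write_of_ne_unlock hr ht₀ hwrite hunlock (fun y => ?_) fun g => ?_
  · obtain ⟨e, hst⟩ := hst
    rcases eq_or_ne y x with rfl | hy
    · rwa [Function.update_self]
    · rw [hst, Function.update_of_ne hy, Function.update_of_ne (Sum.inl_injective.ne hy)]
      exact ht₀.2.2.2.2 (.inl y) rfl
  · rw [Function.update_of_ne Sum.inr_ne_inl]
    exact ht₀.2.2.2.2 (.inr g)

theorem mem_gammaPt_write [DecidableEq G] (h : Prolongs ν t₀ (.write g x) t) (hr : Reachable ν t)
    (ht₀ : t₀ ∈ gammaPt ν γ u S s) :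
    t ∈ gammaPt ν γ t.loc t.locks (Function.update s.1 g (.single S),
      Function.update s.2.1 g (.single S), Function.update s.2.2 (.inr g) (s.2.2 (.inl x))) := by
  obtain ⟨⟨-, rfl⟩, -, hW, hQ, hσ⟩ := ht₀
  have hlocks : t.locks = t₀.locks := h.locks_eq
  have hne {k} (hk : k ≠ g) (y : X) : Act.write g x ≠ (.write k y : Act X G M N R) :=
    fun hy => hk (Act.write.inj hy).1.symm
  refine ⟨⟨hr, rfl⟩, rfl, fun k => ?_, fun k => ?_, ?_⟩
  · rcases eq_or_ne k g with rfl | hk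
    · simpa only [Function.update_self] using hlocks ▸ h.betaW_le_single
    · simpa only [Function.update_of_ne hk] using (h.betaW_le_betaW (hne hk)).trans (hW k)
  · rcases eq_or_ne k g with rfl | hk
    · simpa only [Function.update_self] using hlocks ▸ h.betaP_le_single
    · simpa only [Function.update_of_ne hk] using
        h.betaP_le_of_ne_write (hne hk) (hQ k) fun hS => hlocks ▸ hS
  · rintro (y | k)
    · have hst : t.1.sink.st = t₀.1.sink.st := h.step
      simpa only [betaVal, hst, Function.update_of_ne Sum.inl_ne_inr] using hσ (.inl y)
    · rcases eq_or_ne k g with rfl | hk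
      · simpa only [Function.update_self] using h.betaVal_inr_subset.trans (hσ (.inl x))
      · simpa only [Function.update_of_ne (Sum.inr_injective.ne hk), h.betaVal_inr (hne hk)]
          using hσ (.inr k)

end LocalTrace.Prolongs
end GammaPt

section Values
variable {X G V M N R D : Type u} {η₃ : ∀ x, AbsVal X G M N D x} {u : N} {S S' w : Set M} {g : G}
  {a : M}

/-- The value of the unknown `[u, S]`, as an element of the lattice of abstract states. -/
def ptVal (η₃ : ∀ x, AbsVal X G M N D x) (u : N) (S : Set M) : AbsState X G M D := η₃ (.pt u S)

/-- The value of the unknown `[g, a, S, w]`, as an element of `D`. -/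
def globVal (η₃ : ∀ x, AbsVal X G M N D x) (g : G) (a : M) (S w : Set M) : D := η₃ (.glob g a S w)

variable [CompleteLattice D]

/-- The abstract value obtained when `g` is read at the point `u` with the lockset `S`. -/
def readVal (η₃ : ∀ x, AbsVal X G M N D x) (u : N) (S : Set M) (g : G) : D :=
  (ptVal η₃ u S).2.2 (.inr g) ⊔
    sSup {d | ∃ a S' w, a ∈ S ∧ S ∩ S' = ∅ ∧
      (∃ S'' ∈ ((ptVal η₃ u S).2.1 g).mins, S'' ∩ w = ∅) ∧
      (∃ S''' ∈ ((ptVal η₃ u S).2.1 g).mins, a ∉ S''') ∧ d = globVal η₃ g a S' w}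

theorem globVal_le_readVal (ha : a ∈ S) (hS : Disjoint S S')
    (hw : ∃ T ∈ ((ptVal η₃ u S).2.1 g).mins, Disjoint T w)
    (haT : ∃ T ∈ ((ptVal η₃ u S).2.1 g).mins, a ∉ T) :
    globVal η₃ g a S' w ≤ readVal η₃ u S g :=
  le_sup_of_le_right (le_sSup ⟨a, S', w, ha, hS.inter_eq,
    hw.imp fun _ hT => ⟨hT.1, hT.2.inter_eq⟩, haT, rfl⟩)

end Values

variable {X G V M N R D : Type u} [DecidableEq X] [DecidableEq G] [CompleteLattice D]
  {P : Program X G V M N R} {ν : LocalTrace P → P.tids} {Dm : AbsDomain X G V M N R D}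
  {η₃ : ∀ x, AbsVal X G M N D x} {t t₀ : LocalTrace P} {A : Act X G M N R}

theorem absSystem_edge (hη₃ : IsSolution (absSystem P Dm) η₃) {u A u'} (he : (u, A, u') ∈ P.edges)
    (S : Set M) : (∀ x, (absRhs P Dm u S A η₃).1 x ≤ η₃ x) ∧
      (absRhs P Dm u S A η₃).2 ≤ ptVal η₃ u' (A.lockset S) :=
  hη₃ _ (Or.inr ⟨u, A, u', S, he, rfl⟩)

theorem LocalTrace.Prolongs.mem_gammaPt_absRhs (hDm : Dm.Admissible ν) (h : Prolongs ν t₀ A t)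
    (hr : Reachable ν t)
    (ht₀ : t₀ ∈ gammaPt ν Dm.γ t₀.loc t₀.locks (ptVal η₃ t₀.loc t₀.locks))
    (hread : ∀ x g, A = .read x g → t.1.sink.st x ∈ Dm.γ (readVal η₃ t₀.loc t₀.locks g)) :
    t ∈ gammaPt ν Dm.γ t.loc t.locks (absRhs P Dm t₀.loc t₀.locks A η₃).2 := by
  have hst := h.step
  have hX (x) : t₀.1.sink.st x ∈ Dm.γ ((ptVal η₃ t₀.loc t₀.locks).2.2 (.inl x)) :=
    ht₀.2.2.2.2 (.inl x) rfl
  have hG (g) : t₀.betaVal (.inr g) ⊆ Dm.γ ((ptVal η₃ t₀.loc t₀.locks).2.2 (.inr g)) :=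
    ht₀.2.2.2.2 (.inr g)
  cases A with
  | guard r =>
    obtain ⟨hX', hG'⟩ := hDm.guardT_spec r _ (fun g => t₀.betaVal (.inr g)) _ hst.1 hX hG
    exact h.mem_gammaPt_of_ne_write_of_ne_unlock hr ht₀ nofun nofun (hst.2 ▸ hX') hG'
  | assign y r =>
    obtain ⟨hX', hG'⟩ := hDm.assignT_spec y r _ (fun g => t₀.betaVal (.inr g)) _ hX hG
    rw [← show t.1.sink.st = _ from hst] at hX'
    exact h.mem_gammaPt_of_ne_write_of_ne_unlock hr ht₀ nofun nofun hX' hG'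
  | create x u₁ =>
    refine h.mem_gammaPt_update_inl hr ht₀ nofun nofun (hst.imp fun _ hi => hi.2) ?_
    exact h.create_id x u₁ rfl ▸ hDm.νs_spec _ _ _ _ _ _ _ h.cfg_edge ht₀
  | lock a =>
    rw [← show t.1.sink.st = _ from hst] at hX
    exact h.mem_gammaPt_of_ne_write_of_ne_unlock hr ht₀ nofun nofun hX hG
  | unlock a =>
    rw [← show t.1.sink.st = _ from hst] at hX
    refine h.mem_gammaPt_of_ne_write hr ht₀ nofun (fun _ => le_sup_left) (fun g _ => ?_) hX hG
    exact Or.inr (UpLocks.single_le.1 (h.locks_eq ▸ le_rfl))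
  | read x g => exact h.mem_gammaPt_update_inl hr ht₀ nofun nofun hst (hread x g rfl)
  | write g x => exact h.mem_gammaPt_write hr ht₀

end Transfer

/-! ### Soundness of the analysis -/

section Sound
open LocalTrace

variable {X G V M N R D : Type u} [DecidableEq X] {P : Program X G V M N R}
  {ν : LocalTrace P → P.tids} {Dm : AbsDomain X G V M N R D} {η₃ : ∀ x, AbsVal X G M N D x}
  {t t₀ : LocalTrace P} {A : Act X G M N R} {x : X} {g : G} {a : M}

/-- The local trace `t` is described by the values that `η₃` assigns to the unknowns to which `t`
contributes. -/
structure IsDescribed (ν : LocalTrace P → P.tids) (Dm : AbsDomain X G V M N R D)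
    (η₃ : ∀ x, AbsVal X G M N D x) (t : LocalTrace P) : Prop where
  pt : t ∈ gammaPt ν Dm.γ t.loc t.locks (ptVal η₃ t.loc t.locks)
  glob : ∀ a g v x v', t.LastIs (.unlock a) → t.LastTlWrite g v x v' →
    ∃ w ⊆ t.1.lockset v', v.st x ∈ Dm.γ (globVal η₃ g a t.locks w)

theorem isDescribed_of_idx_zero (h0 : t.1.sink.idx = 0)
    (hpt : t ∈ gammaPt ν Dm.γ t.loc ∅ (ptVal η₃ t.loc ∅)) : IsDescribed ν Dm η₃ t where
  pt := by rwa [show t.locks = ∅ from t.raw.lockset_of_idx_zero h0]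
  glob _ _ _ _ _ _ hl := absurd hl (not_lastTlWrite_of_idx_zero h0)

section Read
variable [CompleteLattice D]

namespace LocalTrace.Prolongs
variable {z z' : Node X V N} {y : X}

theorem mem_readVal_of_self_eq (hγ : Monotone Dm.γ) (h : Prolongs ν t₀ A t)
    (ht₀ : IsDescribed ν Dm η₃ t₀) {o} (ht : t.1.IsGlobalTrace P o)
    (hw : t.1.IsMaxWriteBefore g t₀.1.sink z y z') (hs : z'.st P.self = t₀.id) :
    z.st y ∈ Dm.γ (readVal η₃ t₀.loc t₀.locks g) := by
  have hz := ht.progLe_of_le (t.raw.target_mem hw.edge) (t.raw.source_mem h.edge) hs hw.le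
  have hlast : t₀.LastTlWrite g z y z' := lastTlWrite_of_isMaxWriteBefore hw h.sub hz .refl
  exact hγ le_sup_left (ht₀.pt.2.2.2.2 (.inr g) ⟨z, y, z', hlast, rfl⟩)

theorem mem_readVal_of_self_ne (hP : P.ProtectsAccesses) (hγ : Monotone Dm.γ)
    (h : Prolongs ν t₀ A t) (hfin : t.1.nodes.Finite) (ht₀ : IsDescribed ν Dm η₃ t₀)
    (hpre : PrefixesSatisfy (IsDescribed ν Dm η₃) t) {o} (ht : t.1.IsGlobalTrace P o)
    (hv : t.1.Holds (P.mtx g) t₀.1.sink) (hw : t.1.IsMaxWriteBefore g t₀.1.sink z y z')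
    (hs : z'.st P.self ≠ t₀.id) : z.st y ∈ Dm.γ (readVal η₃ t₀.loc t₀.locks g) := by
  have hsink := t.raw.source_mem h.edge
  have hlocks : t.1.lockset t₀.1.sink = t₀.locks := h.lockset_eq t₀.sink_mem
  obtain ⟨a, ha, r, hr, hzr, hrv, hdisj⟩ := hw.exists_disjoint_release hP ht hfin hv hs
  have hr_ne : r ≠ t.1.sink := by
    rintro rfl
    exact hs (hzr.self_eq.trans h.id_eq)
  obtain ⟨t', hsub, rfl, ht'⟩ := hpre r (t.raw.mem_nodes_of_mem_rel hr) hr_ne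
  have hlast : t'.LastTlWrite g z y z' := lastTlWrite_of_isMaxWriteBefore hw hsub hzr.le hrv
  obtain ⟨r₀, hr₀⟩ := hr
  obtain ⟨w, hwz, hmem⟩ := ht'.glob a g z y z'
    ⟨r₀, hsub.mem_edges t'.raw t.raw hr₀ t'.sink_mem⟩ hlast
  rw [← hsub.lockset_eq t'.raw t.raw hlast.target_mem] at hwz
  have exists_mins {p : Set M → Prop} (hp : Antitone p) (hp0 : p ∅)
      (hex : ∀ v x v', t₀.LastTlWrite g v x v' →
        ∃ n ∈ t.1.nodes, v'.ProgLe P n ∧ n.ProgLe P t₀.1.sink ∧ p (t.1.lockset n)) :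
      ∃ T ∈ ((ptVal η₃ t₀.loc t₀.locks).2.1 g).mins, p T := by
    refine exists_mins_of_betaP_le hp hp0 (hfin.subset h.sub.nodes) (ht₀.pt.2.2.2.1 g) ?_
    intro v x v' hl
    obtain ⟨n, hn, hvn, hns, hpn⟩ := hex v x v' hl
    have hn₀ := h.mem_nodes hn hns
    exact ⟨n, hn₀, hvn, h.lockset_eq hn₀ ▸ hpn⟩
  refine hγ (globVal_le_readVal (hlocks ▸ ha) ?_ ?_ ?_) hmem
  · rw [hsub.lockset_eq t'.raw t.raw t'.sink_mem, hlocks] at hdisj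
    exact hdisj.symm
  · refine exists_mins (fun _ _ hT hd => hd.mono_left hT) (Set.empty_disjoint w) fun v x v' hl => ?_
    obtain ⟨n, hn, hvn, hns, hnz⟩ := hw.exists_disjoint_lockset hP ht hfin hsink hs
      (h.sub.edges hl.1) hl.progLe_sink
    exact ⟨n, hn, hvn, hns, hnz.mono_right hwz⟩
  · exact exists_mins (fun _ _ hT ha' ha => ha' (hT ha)) (Set.notMem_empty a) fun v x v' hl =>
      hw.exists_notMem_lockset hP ht hfin hsink hs ha ⟨r₀, hr₀⟩ hzr hrv (h.sub.edges hl.1)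
        hl.progLe_sink

theorem st_mem_readVal (hP : P.ProtectsAccesses) (hγ : Monotone Dm.γ)
    (h : Prolongs ν t₀ (.read x g) t) (hfin : t.1.nodes.Finite) (ht₀ : IsDescribed ν Dm η₃ t₀)
    (hpre : PrefixesSatisfy (IsDescribed ν Dm η₃) t) :
    t.1.sink.st x ∈ Dm.γ (readVal η₃ t₀.loc t₀.locks g) := by
  obtain ⟨o, ht⟩ := t.2.1
  obtain ⟨z, y, z', e, hle, hmax, hval⟩ := ht.globals _ _ _ _ h.edge
  have hw : t.1.IsMaxWriteBefore g t₀.1.sink z y z' := ⟨e, hle, hmax⟩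
  rw [hval]
  rcases eq_or_ne (z'.st P.self) t₀.id with hs | hs
  · exact h.mem_readVal_of_self_eq hγ ht₀ ht hw hs
  · have hv := hP _ o ht _ (t.raw.source_mem h.edge) _ _ g h.cfg_edge (Or.inl ⟨x, rfl⟩)
    exact h.mem_readVal_of_self_ne hP hγ hfin ht₀ hpre ht hv hw hs

end LocalTrace.Prolongs
end Read

variable [DecidableEq G] [CompleteLattice D]

theorem isDescribed_of_mem_init (hDm : Dm.Admissible ν) (hη₃ : IsSolution (absSystem P Dm) η₃)
    (ht : t ∈ init P) : IsDescribed ν Dm η₃ t := by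
  have h0 : t.1.sink.idx = 0 := by
    obtain ⟨σ, -, ht⟩ := ht
    rw [ht]
    rfl
  have hc : _ ≤ ptVal η₃ t.loc ∅ := loc_of_mem_init ht ▸ (hη₃ _ (Or.inl rfl)).2
  refine isDescribed_of_idx_zero h0 (gammaPt_mono hDm.γ_mono _ _ hc ?_)
  exact mem_gammaPt_of_idx_zero (.init ht) h0 fun x => hDm.γ_top.symm ▸ Set.mem_univ _

theorem IsDescribed.of_mem_new (ht₀ : IsDescribed ν Dm η₃ t₀) (hDm : Dm.Admissible ν)
    (hη₃ : IsSolution (absSystem P Dm) η₃) {u₁} (hr : Reachable ν t) (ht : t ∈ new ν u₁ t₀) :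
    IsDescribed ν Dm η₃ t := by
  have h0 : t.1.sink.idx = 0 := by
    rw [ht.2]
    rfl
  obtain rfl := loc_of_mem_new ht
  obtain ⟨x, u', he⟩ := ht.1
  have hc : _ ≤ ptVal η₃ t.loc ∅ := le_trans (le_iSup_of_le ⟨rfl, rfl⟩ le_rfl)
    ((absSystem_edge hη₃ he t₀.locks).1 (.pt t.loc ∅))
  refine isDescribed_of_idx_zero h0 (gammaPt_mono hDm.γ_mono _ _ hc ?_)
  refine mem_gammaPt_of_idx_zero hr h0 fun y => ?_
  rw [ht.2]
  rcases eq_or_ne y P.self with rfl | hy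
  · simpa [TraceGraph.extendNew] using! hDm.νs_spec _ _ _ _ _ _ _ he ht₀.pt
  · simpa [TraceGraph.extendNew, hy] using! ht₀.pt.2.2.2.2 (.inl y) rfl

theorem LocalTrace.Prolongs.exists_mem_globVal (hγ : Monotone Dm.γ)
    (hη₃ : IsSolution (absSystem P Dm) η₃) (h : Prolongs ν t₀ (.unlock a) t)
    (ht₀ : t₀ ∈ gammaPt ν Dm.γ t₀.loc t₀.locks (ptVal η₃ t₀.loc t₀.locks)) {v v'}
    (hl : t.LastTlWrite g v x v') :
    ∃ w ⊆ t.1.lockset v', v.st x ∈ Dm.γ (globVal η₃ g a t.locks w) := by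
  rw [h.lastTlWrite_iff nofun] at hl
  obtain ⟨-, -, hW, -, hσ⟩ := ht₀
  obtain ⟨w, hwm, hw⟩ := UpLocks.exists_mins_subset (t₀.raw.finite_lockset hl.target_mem)
    (betaW_le.1 (hW g) v x v' hl)
  rw [h.lockset_eq hl.target_mem]
  refine ⟨w, hw, hγ ?_ (hσ (.inr g) ⟨v, x, v', hl, rfl⟩)⟩
  refine le_trans ?_ ((absSystem_edge hη₃ h.cfg_edge t₀.locks).1 (.glob g a t.locks w))
  exact le_iSup_of_le ⟨rfl, h.locks_eq, hwm⟩ le_rfl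

theorem LocalTrace.Prolongs.isDescribed (hP : P.ProtectsAccesses) (hDm : Dm.Admissible ν)
    (hη₃ : IsSolution (absSystem P Dm) η₃) (h : Prolongs ν t₀ A t) (hr : Reachable ν t)
    (ht₀ : IsDescribed ν Dm η₃ t₀) (hpre : PrefixesSatisfy (IsDescribed ν Dm η₃) t) :
    IsDescribed ν Dm η₃ t where
  pt := by
    have hc := (absSystem_edge hη₃ h.cfg_edge t₀.locks).2
    rw [← h.locks_eq] at hc
    refine gammaPt_mono hDm.γ_mono _ _ hc (h.mem_gammaPt_absRhs hDm hr ht₀.pt ?_)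
    rintro x g rfl
    exact h.st_mem_readVal hP hDm.γ_mono hr.finite ht₀ hpre
  glob := by
    rintro a g v x v' ⟨z, e⟩ hl
    obtain ⟨-, rfl⟩ := t.raw.pred_unique h.edge e
    exact h.exists_mem_globVal hDm.γ_mono hη₃ ht₀.pt hl

theorem LocalTrace.Reachable.isDescribed (hP : P.ProtectsAccesses) (hDm : Dm.Admissible ν)
    (hη₃ : IsSolution (absSystem P Dm) η₃) (hr : Reachable ν t) : IsDescribed ν Dm η₃ t :=
  hr.induction_prefixes (fun _ ht => isDescribed_of_mem_init hDm hη₃ ht)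
    (fun _ _ _ hr ht ht₀ => ht₀.of_mem_new hDm hη₃ hr ht)
    (fun _ _ _ hr h hpre ht₀ => h.isDescribed hP hDm hη₃ hr ht₀ hpre)

end Sound

theorem theorem6_general {X G V M N R D : Type u} [DecidableEq X] [DecidableEq G]
    [CompleteLattice D]
    (P : Program X G V M N R) (hP : P.ProtectsAccesses) (ν : LocalTrace P → P.tids)
    (Dm : AbsDomain X G V M N R D) (hDm : Dm.Admissible ν)
    (η : ConcUnk M N → Set (LocalTrace P))
    (hη : IsLeast {η : ConcUnk M N → Set (LocalTrace P) | IsSolution (concSystem ν) η} η)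
    (η₃ : ∀ x, AbsVal X G M N D x) (hη₃ : IsSolution (absSystem P Dm) η₃) :
    (∀ u S, splitPt η u S ⊆ gammaPt ν Dm.γ u S (η₃ (.pt u S))) ∧
    (∀ g a S w, splitGlob η g a S w ⊆
      gammaGlob ν Dm.γ g a S w (⨆ w' ⊆ w, (η₃ (.glob g a S w') : D))) := by
  have hle : η ≤ LocalTrace.reachableTraces ν := hη.2 (LocalTrace.isSolution_reachableTraces ν)
  constructor
  · rintro u S t ⟨ht, rfl⟩
    obtain ⟨hr, rfl⟩ := hle (.pt u) ht
    exact (hr.isDescribed hP hDm hη₃).pt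
  · rintro g a S w t ⟨ht, rfl, hw⟩
    obtain ⟨hr, hlast⟩ := hle (.mx a) ht
    refine ⟨⟨hr, rfl⟩, hlast, hw.imp_left ?_⟩
    rintro ⟨v, x, v', hl, hvw⟩
    obtain ⟨w', hw', hv⟩ := (hr.isDescribed hP hDm hη₃).glob a g v x v'
      (hlast.resolve_left hl.notMem_init) hl
    have hw : w' ⊆ w := hw'.trans hvw
    exact ⟨v, x, v', hl, hDm.γ_mono (le_iSup₂_of_le w' hw le_rfl) hv, hvw⟩

theorem theorem6 {X G V M N R D : Type u} [DecidableEq X] [DecidableEq G] [Finite M]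
    [CompleteLattice D]
    (P : Program X G V M N R) (hP : P.WellFormed) (ν : LocalTrace P → P.tids)
    (Dm : AbsDomain X G V M N R D) (hDm : Dm.Admissible ν)
    (η : ConcUnk M N → Set (LocalTrace P))
    (hη : IsLeast {η : ConcUnk M N → Set (LocalTrace P) | IsSolution (concSystem ν) η} η)
    (η₃ : ∀ x, AbsVal X G M N D x) (hη₃ : IsSolution (absSystem P Dm) η₃) :
    (∀ u S, splitPt η u S ⊆ gammaPt ν Dm.γ u S (η₃ (.pt u S))) ∧
    (∀ g a S w, splitGlob η g a S w ⊆
      gammaGlob ν Dm.γ g a S w (⨆ w' ⊆ w, (η₃ (.glob g a S w') : D))) :=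
  theorem6_general P hP.protectsAccesses ν Dm hDm η hη η₃ hη₃
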